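/- Let $\tau$ be a finite relational signature; all structures have non-empty domains. For a $\tau$-structure $\mathfrak{T}$ (of arbitrary cardinality), $\mathrm{Csp}(\mathfrak{T})$ denotes the class of all finite $\tau$-structures that map homomorphically to $\mathfrak{T}$; a class of this form is called a CSP. A structure $\mathfrak{B}$ is $\omega$-categorical if all countable models of the first-order theory of $\mathfrak{B}$ are isomorphic. A class $\mathcal{C}$ of finite $\tau$-structures is expressed by a sentence $\Phi$ if $\mathcal{C}$ is the class of all finite models of $\Phi$. Guarded second-order formulas are built from atomic formulas ($x=y$, $R(\bar x)$ with $R\in\tau$, and $X(\bar x)$ with $X$ a second-order variable) by Boolean connectives, by guarded first-order quantification $\exists\bar y\,(\alpha\wedge\psi)$ and $\forall\bar y\,(\alpha\Rightarrow\psi)$, where $\alpha$ is an atomic $\tau$-formula (possibly an equality, but not an atom of a second-order variable) in which all free first-order variables of $\psi$ occur, and by unrestricted second-order quantification $\exists X\,\psi$, $\forall X\,\psi$ over relations of any arity. Guarded second-order logic (GSO) consists of these formulas. Its other usual definition is full second-order logic with guarded semantics: the second-order quantifiers range only over guarded relations, i.e. relations each of whose tuples has all its entries among the elements occurring in a single satisfied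 atomic $\tau$-formula (equalities included). Monadic second-order logic (MSO) consists of the second-order formulas all of whose second-order variables are unary. **Corollary 4.2.** Let $\mathcal{C}$ be a CSP over $\tau$ that can be expressed in GSO (under either of the two definitions) or in MSO. Then there exists a countable $\omega$-categorical $\tau$-structure $\mathfrak{B}$ such that $\mathcal{C}=\mathrm{Csp}(\mathfrak{B})$. -/

import Mathlib

open scoped FirstOrder

universe u v w

namespace GSOCsp

/-- A finite structure with non-empty domain (up to isomorphism, every such structure has its
domain in `Type`). -/
structure FinStr (L : FirstOrder.Language.{u, v}) where
  carrier : Type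
  [str : L.Structure carrier]
  [fin : Finite carrier]
  [nonempty : Nonempty carrier]

attribute [instance] FinStr.str FinStr.fin FinStr.nonempty

/-- The constraint satisfaction problem of `B`: the class of all finite structures that map
homomorphically to `B`. -/
def Csp (L : FirstOrder.Language.{u, v}) (B : Type w) [L.Structure B] : Set (FinStr L) :=
  {A | Nonempty (A.carrier →[L] B)}

/-- `B` is `ω`-categorical: all countable models of its first-order theory are isomorphic.
(Every countable model has an isomorphic copy in the universe of `B`.) -/
def IsOmegaCategorical (L : FirstOrder.Language.{u, v}) (B : Type w) [L.Structure B] : Prop :=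
  ∀ (M N : Type w) [L.Structure M] [L.Structure N] [Nonempty M] [Nonempty N]
    [Countable M] [Countable N],
    M ⊨ L.completeTheory B → N ⊨ L.completeTheory B → Nonempty (M ≃[L] N)

/-- A second-order variable: a name together with an arity. -/
structure RelVar where
  arity : ℕ
  name : ℕ
  deriving DecidableEq

/-- Second-order formulas over a relational signature. First-order variables are named by
natural numbers. -/
inductive SOFormula (L : FirstOrder.Language.{u, v}) : Type v
  | eq (x y : ℕ) : SOFormula L
  | rel {n : ℕ} (R : L.Relations n) (x : Fin n → ℕ) : SOFormula L
  | app (X : RelVar) (x : Fin X.arity → ℕ) : SOFormula L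
  | not (φ : SOFormula L) : SOFormula L
  | and (φ ψ : SOFormula L) : SOFormula L
  | or (φ ψ : SOFormula L) : SOFormula L
  | ex (x : ℕ) (φ : SOFormula L) : SOFormula L
  | all (x : ℕ) (φ : SOFormula L) : SOFormula L
  | exRel (X : RelVar) (φ : SOFormula L) : SOFormula L
  | allRel (X : RelVar) (φ : SOFormula L) : SOFormula L

namespace SOFormula

variable {L : FirstOrder.Language.{u, v}}

/-- The free first-order variables. -/
def freeVars : SOFormula L → Set ℕ
  | eq x y => {x, y}
  | rel _ x => Set.range x
  | app _ x => Set.range x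
  | not φ => φ.freeVars
  | and φ ψ => φ.freeVars ∪ ψ.freeVars
  | or φ ψ => φ.freeVars ∪ ψ.freeVars
  | ex x φ => φ.freeVars \ {x}
  | all x φ => φ.freeVars \ {x}
  | exRel _ φ => φ.freeVars
  | allRel _ φ => φ.freeVars

/-- The free second-order variables. -/
def freeRelVars : SOFormula L → Set RelVar
  | eq _ _ => ∅
  | rel _ _ => ∅
  | app X _ => {X}
  | not φ => φ.freeRelVars
  | and φ ψ => φ.freeRelVars ∪ ψ.freeRelVars
  | or φ ψ => φ.freeRelVars ∪ ψ.freeRelVars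
  | ex _ φ => φ.freeRelVars
  | all _ φ => φ.freeRelVars
  | exRel X φ => φ.freeRelVars \ {X}
  | allRel X φ => φ.freeRelVars \ {X}

/-- A sentence has neither free first-order nor free second-order variables. -/
def IsSentence (φ : SOFormula L) : Prop :=
  φ.freeVars = ∅ ∧ φ.freeRelVars = ∅

/-- Tarskian semantics in `A`, under an assignment `s` of the first-order variables and an
assignment `S` of the second-order variables, where the second-order quantifiers range over
the relations that satisfy `P`. -/
def Realize {A : Type w} [L.Structure A] (P : ∀ n : ℕ, Set (Fin n → A) → Prop) :
    SOFormula L → (ℕ → A) → (∀ X : RelVar, Set (Fin X.arity → A)) → Prop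
  | eq x y, s, _ => s x = s y
  | rel R x, s, _ => FirstOrder.Language.Structure.RelMap R (fun i => s (x i))
  | app X x, s, S => (fun i => s (x i)) ∈ S X
  | not φ, s, S => ¬ φ.Realize P s S
  | and φ ψ, s, S => φ.Realize P s S ∧ ψ.Realize P s S
  | or φ ψ, s, S => φ.Realize P s S ∨ ψ.Realize P s S
  | ex x φ, s, S => ∃ a : A, φ.Realize P (Function.update s x a) S
  | all x φ, s, S => ∀ a : A, φ.Realize P (Function.update s x a) S
  | exRel X φ, s, S => ∃ R : Set (Fin X.arity → A),
      P X.arity R ∧ φ.Realize P s (Function.update S X R)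
  | allRel X φ, s, S => ∀ R : Set (Fin X.arity → A),
      P X.arity R → φ.Realize P s (Function.update S X R)

/-- All second-order variables are unary. -/
def IsMonadic : SOFormula L → Prop
  | eq _ _ => True
  | rel _ _ => True
  | app X _ => X.arity = 1
  | not φ => φ.IsMonadic
  | and φ ψ => φ.IsMonadic ∧ ψ.IsMonadic
  | or φ ψ => φ.IsMonadic ∧ ψ.IsMonadic
  | ex _ φ => φ.IsMonadic
  | all _ φ => φ.IsMonadic
  | exRel X φ => X.arity = 1 ∧ φ.IsMonadic
  | allRel X φ => X.arity = 1 ∧ φ.IsMonadic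

/-- Atomic formulas over the given signature, without second-order variables. -/
inductive IsSigAtom : SOFormula L → Prop
  | eq (x y : ℕ) : IsSigAtom (.eq x y)
  | rel {n : ℕ} (R : L.Relations n) (x : Fin n → ℕ) : IsSigAtom (.rel R x)

/-- Existential quantification over a tuple of first-order variables. -/
def exs (ys : List ℕ) (φ : SOFormula L) : SOFormula L := ys.foldr ex φ

/-- Universal quantification over a tuple of first-order variables. -/
def alls (ys : List ℕ) (φ : SOFormula L) : SOFormula L := ys.foldr all φ

/-- Guarded second-order formulas: first-order quantifiers are relativised to atoms over the
given signature (not to second-order variables), second-order quantification is unrestricted. -/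
inductive IsGuarded : SOFormula L → Prop
  | eq (x y : ℕ) : IsGuarded (.eq x y)
  | rel {n : ℕ} (R : L.Relations n) (x : Fin n → ℕ) : IsGuarded (.rel R x)
  | app (X : RelVar) (x : Fin X.arity → ℕ) : IsGuarded (.app X x)
  | not {φ : SOFormula L} : IsGuarded φ → IsGuarded (.not φ)
  | and {φ ψ : SOFormula L} : IsGuarded φ → IsGuarded ψ → IsGuarded (.and φ ψ)
  | or {φ ψ : SOFormula L} : IsGuarded φ → IsGuarded ψ → IsGuarded (.or φ ψ)
  | exs (ys : List ℕ) {α ψ : SOFormula L} : IsSigAtom α → IsGuarded ψ →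
      ψ.freeVars ⊆ α.freeVars → IsGuarded (SOFormula.exs ys (.and α ψ))
  | alls (ys : List ℕ) {α ψ : SOFormula L} : IsSigAtom α → IsGuarded ψ →
      ψ.freeVars ⊆ α.freeVars → IsGuarded (SOFormula.alls ys (.or (.not α) ψ))
  | exRel (X : RelVar) {φ : SOFormula L} : IsGuarded φ → IsGuarded (.exRel X φ)
  | allRel (X : RelVar) {φ : SOFormula L} : IsGuarded φ → IsGuarded (.allRel X φ)

end SOFormula

/-- The entries of `t` all occur in one satisfied atomic formula over the signature of `A`:
an equality `x = y` (first case) or a relational atom (second case). -/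
def IsGuardedTuple (L : FirstOrder.Language.{u, v}) {A : Type w} [L.Structure A] {n : ℕ}
    (t : Fin n → A) : Prop :=
  (∃ a : A, Set.range t ⊆ {a}) ∨
    ∃ (k : ℕ) (R : L.Relations k) (b : Fin k → A),
      FirstOrder.Language.Structure.RelMap R b ∧ Set.range t ⊆ Set.range b

/-- A relation all of whose tuples are guarded. -/
def IsGuardedRel (L : FirstOrder.Language.{u, v}) {A : Type w} [L.Structure A] (n : ℕ)
    (R : Set (Fin n → A)) : Prop :=
  ∀ t ∈ R, IsGuardedTuple L t

/-- The class of finite models of `Φ`. For a sentence the assignment is irrelevant. -/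
def finModels {L : FirstOrder.Language.{u, v}} (Φ : SOFormula L) : Set (FinStr L) :=
  {A | ∀ (s : ℕ → A.carrier) (S : ∀ X : RelVar, Set (Fin X.arity → A.carrier)),
    Φ.Realize (fun _ _ => True) s S}

/-- The class of finite models of `Φ` with guarded semantics: second-order quantifiers range
over guarded relations only. -/
def finModelsGuarded {L : FirstOrder.Language.{u, v}} (Φ : SOFormula L) : Set (FinStr L) :=
  {A | ∀ (s : ℕ → A.carrier) (S : ∀ X : RelVar, Set (Fin X.arity → A.carrier)),
    Φ.Realize (IsGuardedRel L) s S}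

/-- `C` is expressible in guarded second-order logic. -/
def InGSO {L : FirstOrder.Language.{u, v}} (C : Set (FinStr L)) : Prop :=
  ∃ Φ : SOFormula L, Φ.IsSentence ∧ Φ.IsGuarded ∧ C = finModels Φ

/-- `C` is expressible in full second-order logic with guarded semantics (the other usual
definition of guarded second-order logic). -/
def InGuardedSemanticsSO {L : FirstOrder.Language.{u, v}} (C : Set (FinStr L)) : Prop :=
  ∃ Φ : SOFormula L, Φ.IsSentence ∧ C = finModelsGuarded Φ

/-- `C` is expressible in monadic second-order logic. -/
def InMSO {L : FirstOrder.Language.{u, v}} (C : Set (FinStr L)) : Prop :=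
  ∃ Φ : SOFormula L, Φ.IsSentence ∧ Φ.IsMonadic ∧ C = finModels Φ

end GSOCsp

/-! Call two primitive positive (pp) formulas with `n` free variables equivalent if they are jointly
satisfiable in `T` with the same pp formulas. The proof shows that definability makes this
Myhill–Nerode equivalence of finite index for every `n`, and that finite index yields an
ω-categorical template.

Finite index. Joint satisfiability of `F` and `G` says that the free amalgam of their canonical
structures over the free variables lies in `Csp L T` (`jointlySat_iff`). A Feferman–Vaught argument
(`composes`) shows that the truth of a fixed second-order sentence in a free amalgam depends on the
left side only through finitely much information. It works under guarded semantics because a guarded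
tuple never straddles the two sides, so that a guarded relation on the amalgam is the union of one
on each side (`IsFreeAmalgam.isGuardedRel_iff`). Syntactic GSO and MSO both reduce to guarded
semantics.

The template. A generic structure on `ℕ` is built from finite sets of facts satisfiable in `T`
(`exists_isGeneric`). It has the same CSP as `T` (`IsGeneric.csp_eq`), and a pp formula holds at an
injective tuple as soon as it is jointly satisfiable with each pp formula true there
(`IsGeneric.exists_sat`). Hence pp types of injective tuples are maximal, and each is determined by
the equivalence classes that it meets. With finite index there are finitely many of them, and
equality of pp types is a back-and-forth system (`IsGeneric.exists_extension`). So there are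
finitely many first-order types of each length, and Ryll-Nardzewski gives ω-categoricity. -/

namespace GSOCsp

open FirstOrder FirstOrder.Language

/-! ### First-order types, and ω-categoricity from finitely many of them. -/

section Types

variable (L : FirstOrder.Language.{u, v})

/-- The tuples `b` and `b'` satisfy the same first-order formulas. -/
def SameType {M N : Type*} [L.Structure M] [L.Structure N] {n : ℕ}
    (b : Fin n → M) (b' : Fin n → N) : Prop :=
  ∀ φ : L.BoundedFormula Empty n, φ.Realize default b ↔ φ.Realize default b'

variable {L}

theorem SameType.symm {M N : Type*} [L.Structure M] [L.Structure N] {n : ℕ}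
    {b : Fin n → M} {b' : Fin n → N} (h : SameType L b b') : SameType L b' b :=
  fun φ => (h φ).symm

theorem SameType.eq_iff {M N : Type*} [L.Structure M] [L.Structure N] {n : ℕ}
    {b : Fin n → M} {b' : Fin n → N} (h : SameType L b b') (i j : Fin n) :
    b i = b j ↔ b' i = b' j := by
  have := h (.equal (.var (.inr i)) (.var (.inr j)))
  simpa [BoundedFormula.Realize] using this

theorem SameType.relMap_iff {M N : Type*} [L.Structure M] [L.Structure N] {n k : ℕ}
    {b : Fin n → M} {b' : Fin n → N} (h : SameType L b b') (R : L.Relations k)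
    (x : Fin k → Fin n) :
    Structure.RelMap R (fun i => b (x i)) ↔ Structure.RelMap R (fun i => b' (x i)) := by
  have := h (.rel R fun i => .var (.inr (x i)))
  simpa [BoundedFormula.Realize] using this

theorem forall_realize_iff_of_model {B M : Type*} [L.Structure B] [L.Structure M]
    (hM : M ⊨ L.completeTheory B) {n : ℕ} (φ : L.BoundedFormula Empty n) :
    (∀ b : Fin n → M, φ.Realize default b) ↔ ∀ b : Fin n → B, φ.Realize default b := by
  have h := realize_iff_of_model_completeTheory (L := L) B M φ.alls
  rw [Sentence.Realize, Sentence.Realize, Formula.Realize, Formula.Realize] at h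
  have h1 := (BoundedFormula.realize_alls (φ := φ) (v := (default : Empty → M)))
  have h2 := (BoundedFormula.realize_alls (φ := φ) (v := (default : Empty → B)))
  exact h1.symm.trans (h.trans h2)

/-- If there are only finitely many types of `n`-tuples, then finitely many formulas isolate
them. -/
theorem exists_isolating {B : Type*} [L.Structure B] {n : ℕ} {τ : Type*} [Finite τ]
    (g : (Fin n → B) → τ) (hg : ∀ b b', g b = g b' → SameType L b b') :
    ∃ φ : Set.range g → L.BoundedFormula Empty n,
      (∀ b : Fin n → B, ∃ v, (φ v).Realize default b) ∧
      ∀ v (b b' : Fin n → B), (φ v).Realize default b → (φ v).Realize default b' →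
        SameType L b b' := by
  classical
  -- Distinct values of `g` may carry the same type, so the second clause only asks that `ψ` exclude
  -- `w` when the types differ. The conjunction of `ψ v w` over all `w` then isolates the type of
  -- `v`.
  have sep : ∀ v w : Set.range g, ∃ ψ : L.BoundedFormula Empty n,
      (∀ b : Fin n → B, g b = v → ψ.Realize default b) ∧
      ((∃ b : Fin n → B, g b = w ∧ ψ.Realize default b) → ∀ b b', g b = v → g b' = w → SameType L b b') := by
    rintro ⟨_, b, rfl⟩ ⟨_, b', rfl⟩
    by_cases h : SameType L b b'
    · refine ⟨⊤, fun _ _ => by simp, fun _ c c' hc hc' φ => ?_⟩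
      exact (hg _ _ hc φ).trans ((h φ).trans (hg _ _ hc' φ).symm)
    · simp only [SameType, not_forall] at h
      obtain ⟨ψ, hψ⟩ := h
      by_cases hb : ψ.Realize default b
      · refine ⟨ψ, fun c hc => (hg _ _ hc ψ).2 hb, ?_⟩
        rintro ⟨c, hc, hc'⟩
        exact absurd (iff_of_true hb ((hg _ _ hc ψ).1 hc')) hψ
      · refine ⟨ψ.not, fun c hc => ?_, ?_⟩
        · rw [BoundedFormula.realize_not]
          exact fun h => hb ((hg _ _ hc ψ).1 h)
        · rintro ⟨c, hc, hc'⟩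
          rw [BoundedFormula.realize_not] at hc'
          exact absurd (iff_of_false hb fun h => hc' ((hg _ _ hc ψ).2 h)) hψ
  choose ψ hψ hψ' using sep
  refine ⟨fun v => .iInf (ψ v), fun b => ⟨⟨g b, b, rfl⟩, ?_⟩, fun v b b' hb hb' => ?_⟩
  · rw [BoundedFormula.realize_iInf]
    exact fun w => hψ _ w b rfl
  · rw [BoundedFormula.realize_iInf] at hb hb'
    obtain ⟨_, c, rfl⟩ := v
    have h1 := hψ' _ ⟨g b, b, rfl⟩ ⟨b, rfl, hb _⟩ c b rfl rfl
    have h2 := hψ' _ ⟨g b', b', rfl⟩ ⟨b', rfl, hb' _⟩ c b' rfl rfl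
    exact fun φ => (h1 φ).symm.trans (h2 φ)

/-- There are only finitely many types of `n`-tuples in `B`, for every `n`. -/
def FinitelyManyTypes (L : FirstOrder.Language.{u, v}) (B : Type w) [L.Structure B] : Prop :=
  ∀ n, ∃ (τ : Type) (_ : Finite τ) (g : (Fin n → B) → τ), ∀ b b', g b = g b' → SameType L b b'

/-- The extended tuple satisfies one of finitely many isolating formulas. Its existential closure
over the last variable belongs to the common type, which provides `c'`. That the formula still
isolates a type in `M` and `N` is read off from the theory of `B`. -/
theorem SameType.exists_extension {B : Type w} [L.Structure B] (hB : FinitelyManyTypes L B)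
    {M N : Type*} [L.Structure M] [L.Structure N]
    (hM : M ⊨ L.completeTheory B) (hN : N ⊨ L.completeTheory B) {n : ℕ}
    {b : Fin n → M} {b' : Fin n → N} (h : SameType L b b') (c : M) :
    ∃ c' : N, SameType L (Fin.snoc b c : Fin (n + 1) → M) (Fin.snoc b' c' : Fin (n + 1) → N) := by
  obtain ⟨τ, _, g, hg⟩ := hB (n + 1)
  obtain ⟨φ, hcov, hiso⟩ := exists_isolating g hg
  have hcovM := (forall_realize_iff_of_model hM (.iSup φ)).2
    (fun b => BoundedFormula.realize_iSup.2 (hcov b)) (Fin.snoc b c)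
  obtain ⟨v, hv⟩ := BoundedFormula.realize_iSup.1 hcovM
  have hex := (h (φ v).ex).1 (BoundedFormula.realize_ex.2 ⟨c, hv⟩)
  obtain ⟨c', hc'⟩ := BoundedFormula.realize_ex.1 hex
  refine ⟨c', fun ψ => ?_⟩
  -- Isolation means that `φ v` decides `ψ` in `B`. Either alternative is a universal sentence of
  -- the theory of `B`, hence true in both `M` and `N`.
  have key : (∀ d : Fin (n + 1) → B, ((φ v).imp ψ).Realize default d) ∨
      (∀ d : Fin (n + 1) → B, ((φ v).imp ψ.not).Realize default d) := by
    by_contra! hcon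
    obtain ⟨⟨d, hd⟩, ⟨d', hd'⟩⟩ := hcon
    simp only [BoundedFormula.realize_imp, BoundedFormula.realize_not, Classical.not_imp, not_not] at hd hd'
    exact hd.2 ((hiso v d d' hd.1 hd'.1 ψ).2 hd'.2)
  rcases key with key | key
  · have h1 := (forall_realize_iff_of_model hM _).2 key (Fin.snoc b c)
    have h2 := (forall_realize_iff_of_model hN _).2 key (Fin.snoc b' c')
    rw [BoundedFormula.realize_imp] at h1 h2
    exact iff_of_true (h1 hv) (h2 hc')
  · have h1 := (forall_realize_iff_of_model hM _).2 key (Fin.snoc b c)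
    have h2 := (forall_realize_iff_of_model hN _).2 key (Fin.snoc b' c')
    rw [BoundedFormula.realize_imp, BoundedFormula.realize_not] at h1 h2
    exact iff_of_false (h1 hv) (h2 hc')

variable (L) in
/-- A pair of finite tuples of the same type: a finite partial elementary map. -/
structure PartialElementary (M N : Type*) [L.Structure M] [L.Structure N] where
  n : ℕ
  left : Fin n → M
  right : Fin n → N
  sameType : SameType L left right

variable {M N : Type*} [L.Structure M] [L.Structure N]

/-- The graph of a finite partial elementary map. -/
def PartialElementary.graph (p : PartialElementary L M N) : Set (M × N) :=
  Set.range fun i => (p.left i, p.right i)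

instance : Preorder (PartialElementary L M N) := Preorder.lift PartialElementary.graph

theorem PartialElementary.exists_extend_left {B : Type w} [L.Structure B]
    (hB : FinitelyManyTypes L B)
    (hM : M ⊨ L.completeTheory B) (hN : N ⊨ L.completeTheory B) (p : PartialElementary L M N)
    (c : M) : ∃ q, (∃ c', (c, c') ∈ q.graph) ∧ p ≤ q := by
  obtain ⟨c', h⟩ := p.sameType.exists_extension hB hM hN c
  refine ⟨⟨_, _, _, h⟩, ⟨c', Fin.last _, by simp⟩, ?_⟩
  rintro _ ⟨i, rfl⟩
  exact ⟨i.castSucc, by simp⟩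

theorem PartialElementary.exists_extend_right {B : Type w} [L.Structure B]
    (hB : FinitelyManyTypes L B)
    (hM : M ⊨ L.completeTheory B) (hN : N ⊨ L.completeTheory B) (p : PartialElementary L M N)
    (c' : N) : ∃ q, (∃ c, (c, c') ∈ q.graph) ∧ p ≤ q := by
  obtain ⟨c, h⟩ := p.sameType.symm.exists_extension hB hN hM c'
  refine ⟨⟨_, _, _, h.symm⟩, ⟨c, Fin.last _, by simp⟩, ?_⟩
  rintro _ ⟨i, rfl⟩
  exact ⟨i.castSucc, by simp⟩

/-- Ryll-Nardzewski: a structure with finitely many types of `n`-tuples for every `n` is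
`ω`-categorical. -/
theorem FinitelyManyTypes.isOmegaCategorical [L.IsRelational] {B : Type w} [L.Structure B]
    (hB : FinitelyManyTypes L B) : IsOmegaCategorical L B := by
  classical
  intro M N _ _ _ _ _ _ hM hN
  let p₀ : PartialElementary L M N := ⟨0, Fin.elim0, Fin.elim0, fun φ => by
    have h := (forall_realize_iff_of_model hM φ).trans (forall_realize_iff_of_model hN φ).symm
    simp only [Subsingleton.elim _ (Fin.elim0 : Fin 0 → M),
      Subsingleton.elim _ (Fin.elim0 : Fin 0 → N), forall_const] at h
    exact h⟩
  have := Encodable.ofCountable M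
  have := Encodable.ofCountable N
  -- One cofinal set per element of either model. By countability some ideal meets them all, and the
  -- union of its graphs is total in both directions.
  let D : M ⊕ N → Order.Cofinal (PartialElementary L M N) := Sum.elim
    (fun c => ⟨{q | ∃ c', (c, c') ∈ q.graph}, fun p =>
      PartialElementary.exists_extend_left hB hM hN p c⟩)
    (fun c' => ⟨{q | ∃ c, (c, c') ∈ q.graph}, fun p =>
      PartialElementary.exists_extend_right hB hM hN p c'⟩)
  let I := Order.idealOfCofinals p₀ D
  have hI : DirectedOn (fun p q : PartialElementary L M N => p.graph ⊆ q.graph) (I : Set _) :=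
    I.directed
  let G : Set (M × N) := ⋃ p ∈ (I : Set (PartialElementary L M N)), p.graph
  have hfin : ∀ s : Finset (M × N), (s : Set (M × N)) ⊆ G → ∃ p : PartialElementary L M N,
      (s : Set (M × N)) ⊆ p.graph := fun s hs =>
    (hI.exists_mem_subset_of_finset_subset_biUnion I.nonempty hs).imp fun _ h => h.2
  have hl : ∀ c, ∃ c', (c, c') ∈ G := fun c => by
    obtain ⟨p, ⟨c', hp⟩, hpI⟩ := Order.cofinal_meets_idealOfCofinals p₀ D (.inl c)
    exact ⟨c', Set.mem_biUnion hpI hp⟩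
  have hr : ∀ c', ∃ c, (c, c') ∈ G := fun c' => by
    obtain ⟨p, ⟨c, hp⟩, hpI⟩ := Order.cofinal_meets_idealOfCofinals p₀ D (.inr c')
    exact ⟨c, Set.mem_biUnion hpI hp⟩
  have hiff : ∀ a a' b b', (a, a') ∈ G → (b, b') ∈ G → (a = b ↔ a' = b') := by
    intro a a' b b' ha hb
    obtain ⟨p, hp⟩ := hfin {(a, a'), (b, b')} (by
      simp [Set.insert_subset_iff, ha, hb])
    obtain ⟨i, hi⟩ := hp (by simp : (a, a') ∈ _)
    obtain ⟨j, hj⟩ := hp (by simp : (b, b') ∈ _)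
    simp only [Prod.mk.injEq] at hi hj
    rw [← hi.1, ← hi.2, ← hj.1, ← hj.2]
    exact p.sameType.eq_iff i j
  choose f hf using hl
  choose f' hf' using hr
  refine ⟨⟨⟨f, f', fun a => ?_, fun b => ?_⟩, fun {n} F => isEmptyElim F, fun {n} R x => ?_⟩⟩
  · exact (hiff _ _ _ _ (hf' (f a)) (hf a)).2 rfl
  · exact (hiff _ _ _ _ (hf (f' b)) (hf' b)).1 rfl
  · obtain ⟨p, hp⟩ := hfin (Finset.univ.image fun i => (x i, f (x i))) (by
      intro y hy
      simp only [Finset.coe_image, Finset.coe_univ, Set.image_univ, Set.mem_range] at hy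
      obtain ⟨i, rfl⟩ := hy
      exact hf _)
    have : ∀ i, ∃ j, (p.left j, p.right j) = (x i, f (x i)) := fun i => hp (by simpa using ⟨i, rfl, rfl⟩)
    choose y hy using this
    simp only [Prod.mk.injEq] at hy
    have := p.sameType.relMap_iff R y
    simp only [hy] at this
    exact this.symm

end Types

end GSOCsp

namespace GSOCsp

open FirstOrder FirstOrder.Language

/-- A symmetric back-and-forth system on `B` that preserves atomic formulas preserves all
first-order formulas. -/
theorem sameType_of_backAndForth {L : FirstOrder.Language.{u, v}} [L.IsRelational]
    {B : Type w} [L.Structure B] (E : ∀ n, (Fin n → B) → (Fin n → B) → Prop)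
    (symm : ∀ n b b', E n b b' → E n b' b)
    (eq : ∀ n b b', E n b b' → ∀ i j, b i = b j → b' i = b' j)
    (rel : ∀ n b b', E n b b' → ∀ {k} (R : L.Relations k) (x : Fin k → Fin n),
      Structure.RelMap R (fun i => b (x i)) → Structure.RelMap R (fun i => b' (x i)))
    (ext : ∀ n b b', E n b b' → ∀ c, ∃ c', E (n + 1) (Fin.snoc b c) (Fin.snoc b' c'))
    {n : ℕ} {b b' : Fin n → B} (h : E n b b') : SameType L b b' := by
  have hterm : ∀ {n} (t : L.Term (Empty ⊕ Fin n)), ∃ i : Fin n, t = .var (.inr i) := by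
    rintro n (x | f)
    · rcases x with x | i
      · exact x.elim
      · exact ⟨i, rfl⟩
    · exact isEmptyElim f
  intro φ
  induction φ with
  | falsum => exact Iff.rfl
  | equal t₁ t₂ =>
    obtain ⟨i, rfl⟩ := hterm t₁
    obtain ⟨j, rfl⟩ := hterm t₂
    simpa [BoundedFormula.Realize] using ⟨eq _ _ _ h i j, eq _ _ _ (symm _ _ _ h) i j⟩
  | rel R ts =>
    choose x hx using fun i => hterm (ts i)
    obtain rfl : ts = fun i => .var (.inr (x i)) := funext hx
    simpa [BoundedFormula.Realize] using ⟨rel _ _ _ h R x, rel _ _ _ (symm _ _ _ h) R x⟩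
  | imp φ ψ ihφ ihψ => rw [BoundedFormula.realize_imp, BoundedFormula.realize_imp, ihφ h, ihψ h]
  | all φ ih =>
    rw [BoundedFormula.realize_all, BoundedFormula.realize_all]
    constructor
    · intro hφ c
      obtain ⟨c', hc⟩ := ext _ _ _ (symm _ _ _ h) c
      exact (ih hc).2 (hφ c')
    · intro hφ c
      obtain ⟨c', hc⟩ := ext _ _ _ h c
      exact (ih hc).2 (hφ c')

/-! ### Finite sets of facts, and generic structures on `ℕ`. -/

section Facts

variable (L : FirstOrder.Language.{u, v})

/-- A relational fact over the set of elements (or variables) `V`. -/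
abbrev Fact (V : Type*) := Σ r : (Σ k : ℕ, L.Relations k), Fin r.1 → V

variable {L}

/-- Renaming the elements of a fact. -/
def Fact.map {V W : Type*} (g : V → W) (f : Fact L V) : Fact L W := ⟨f.1, g ∘ f.2⟩

/-- The valuation `h` satisfies the conjunction of the facts in `F`. -/
def Sat {V M : Type*} [L.Structure M] (F : Finset (Fact L V)) (h : V → M) : Prop :=
  ∀ f ∈ F, Structure.RelMap f.1.2 (h ∘ f.2)

theorem sat_image {V W M : Type*} [DecidableEq (Fact L W)] [L.Structure M]
    {F : Finset (Fact L V)} {g : V → W} {h : W → M} :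
    Sat (F.image (Fact.map g)) h ↔ Sat F (h ∘ g) := by
  simp only [Sat, Finset.forall_mem_image]
  rfl

theorem sat_union {V M : Type*} [DecidableEq (Fact L V)] [L.Structure M]
    {F G : Finset (Fact L V)} {h : V → M} : Sat (F ∪ G) h ↔ Sat F h ∧ Sat G h := by
  simp only [Sat, Finset.mem_union, or_imp, forall_and]

theorem sat_biUnion {ι V M : Type*} [DecidableEq (Fact L V)] [L.Structure M] {s : Finset ι}
    {F : ι → Finset (Fact L V)} {h : V → M} : Sat (s.biUnion F) h ↔ ∀ i ∈ s, Sat (F i) h := by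
  simp only [Sat, Finset.mem_biUnion]
  exact ⟨fun H i hi f hf => H f ⟨i, hi, hf⟩, fun H f ⟨i, hi, hf⟩ => H i hi f hf⟩

theorem Sat.mono {V M : Type*} [L.Structure M] {F G : Finset (Fact L V)} {h : V → M}
    (hG : Sat G h) (hFG : F ⊆ G) : Sat F h := fun f hf => hG f (hFG hf)

theorem exists_facts_lt (s : Finset (Fact L ℕ)) : ∃ m, ∀ f ∈ s, ∀ i, f.2 i < m := by
  classical
  refine ⟨(s.sup fun f => Finset.univ.sup f.2) + 1, fun f hf i => ?_⟩
  have h1 : f.2 i ≤ Finset.univ.sup f.2 := Finset.le_sup (Finset.mem_univ i)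
  have h2 : Finset.univ.sup f.2 ≤ s.sup fun f => Finset.univ.sup f.2 :=
    Finset.le_sup (f := fun f : Fact L ℕ => Finset.univ.sup f.2) hf
  omega

/-- The structure on `V` whose relations are given by the facts in `F`. -/
@[reducible] def structureOfFacts [L.IsRelational] {V : Type*} (F : Set (Fact L V)) :
    L.Structure V where
  funMap f := isEmptyElim f
  RelMap R x := ⟨⟨_, R⟩, x⟩ ∈ F

/-- A structure on `ℕ` all of whose finite parts map to `T`, and which realises, by large
elements, every finite set of facts that is compatible with `T` over finite parts. -/
structure IsGeneric (T : Type w) [L.Structure T] [L.Structure ℕ] : Prop where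
  consistent (s : Finset (Fact L ℕ)) : Sat s (id : ℕ → ℕ) → ∃ h : ℕ → T, Sat s h
  realize (K : Finset (Fact L (ℕ ⊕ ℕ))) (N : ℕ) :
    (∀ s : Finset (Fact L ℕ), Sat s (id : ℕ → ℕ) →
      ∃ h g : ℕ → T, Sat s h ∧ Sat K (Sum.elim h g)) →
    ∃ g : ℕ → ℕ, (∀ x, N ≤ g x) ∧ Sat K (Sum.elim id g)

/-- A Rasiowa–Sikorski construction. The conditions are the finite sets of facts satisfiable in `T`,
and there is one requirement for each pair `(K, N)`: if `K` is still compatible with the condition,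
then it is realised there by elements above `N`. There are countably many requirements. -/
theorem exists_isGeneric [L.IsRelational] [Countable (Σ k : ℕ, L.Relations k)]
    (T : Type w) [L.Structure T] [Nonempty T] :
    ∃ _ : L.Structure ℕ, IsGeneric (L := L) T := by
  classical
  let P := {s : Finset (Fact L ℕ) // ∃ h : ℕ → T, Sat s h}
  let D : Finset (Fact L (ℕ ⊕ ℕ)) × ℕ → Order.Cofinal P := fun K =>
    ⟨{s | (∃ h g : ℕ → T, Sat s.1 h ∧ Sat K.1 (Sum.elim h g)) →
      ∃ g : ℕ → ℕ, (∀ x, K.2 ≤ g x) ∧ ∀ f ∈ K.1, f.map (Sum.elim id g) ∈ s.1}, by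
      intro s
      by_cases hs : ∃ h g : ℕ → T, Sat s.1 h ∧ Sat K.1 (Sum.elim h g)
      · obtain ⟨h, g, hh, hg⟩ := hs
        obtain ⟨m₁, hm₁⟩ := exists_facts_lt s.1
        obtain ⟨m₂, hm₂⟩ := exists_facts_lt (K.1.image (Fact.map (Sum.elim id fun _ => 0)))
        let m := max K.2 (max m₁ m₂)
        have h₁ : m₁ ≤ m := (le_max_left _ _).trans (le_max_right _ _)
        have h₂ : m₂ ≤ m := (le_max_right _ _).trans (le_max_right _ _)
        -- The facts of `s` and the parameters of `K` mention only elements below `m`, so the bound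
        -- variables of `K` can be placed from `m` on without disturbing `h`.
        let h' : ℕ → T := fun x => if x < m then h x else g (x - m)
        refine ⟨⟨s.1 ∪ K.1.image (Fact.map (Sum.elim id fun x => m + x)), h', ?_⟩, ?_, ?_⟩
        · rw [sat_union, sat_image]
          refine ⟨fun f hf => ?_, fun f hf => ?_⟩
          · convert hh f hf using 1
            funext i
            have := hm₁ f hf i
            simp only [Function.comp_apply, h']
            rw [if_pos (by omega)]
          · convert hg f hf using 1
            funext i
            have := hm₂ _ (Finset.mem_image_of_mem _ hf) i
            simp only [Fact.map, Function.comp_apply] at this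
            simp only [Function.comp_apply, h']
            rcases hfi : f.2 i with x | x
            · rw [hfi] at this
              simp only [Sum.elim_inl, id_eq] at this
              exact if_pos (show x < m from lt_of_lt_of_le this h₂)
            · simp
        · exact fun _ => ⟨fun x => m + x, fun x => (le_max_left _ _).trans (Nat.le_add_right m x),
            fun f hf => Finset.mem_union_right _ (Finset.mem_image_of_mem _ hf)⟩
        · exact Finset.subset_union_left
      · exact ⟨s, fun h => absurd h hs, le_rfl⟩⟩
  have := Encodable.ofCountable (Finset (Fact L (ℕ ⊕ ℕ)) × ℕ)
  let p₀ : P := ⟨∅, fun _ => Classical.arbitrary T, fun f hf => by simp at hf⟩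
  let I := Order.idealOfCofinals p₀ D
  have hI : DirectedOn (fun p q : P => (p.1 : Set (Fact L ℕ)) ⊆ q.1) (I : Set P) :=
    I.directed
  let G : Set (Fact L ℕ) := ⋃ p ∈ (I : Set P), (p.1 : Set (Fact L ℕ))
  let _ : L.Structure ℕ := structureOfFacts G
  refine ⟨inferInstance, ⟨fun s hs => ?_, fun K N hK => ?_⟩⟩
  · obtain ⟨p, -, hp⟩ := hI.exists_mem_subset_of_finset_subset_biUnion (s := s) I.nonempty hs
    exact p.2.imp fun h hh => hh.mono hp
  · obtain ⟨p, hp, hpI⟩ := Order.cofinal_meets_idealOfCofinals p₀ D (K, N)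
    have hpG : ∀ f ∈ p.1, f ∈ G := fun f hf => Set.mem_biUnion hpI hf
    obtain ⟨g, hg, hgK⟩ := hp (hK p.1 hpG)
    exact ⟨g, hg, fun f hf => hpG _ (hgK f hf)⟩

/-- The positive type of `d`: the primitive positive formulas that it satisfies. -/
def ppType {M : Type*} [L.Structure M] {n : ℕ} (d : Fin n → M) :
    Set (Finset (Fact L (Fin n ⊕ ℕ))) :=
  {F | ∃ g : ℕ → M, Sat F (Sum.elim d g)}

/-- Two primitive positive formulas are jointly satisfiable in `T`. -/
def JointlySat (T : Type w) [L.Structure T] {n : ℕ} (F G : Finset (Fact L (Fin n ⊕ ℕ))) : Prop :=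
  ∃ (h : Fin n → T) (g g' : ℕ → T), Sat F (Sum.elim h g) ∧ Sat G (Sum.elim h g')

theorem JointlySat.symm {T : Type w} [L.Structure T] {n : ℕ}
    {F G : Finset (Fact L (Fin n ⊕ ℕ))} : JointlySat T F G → JointlySat T G F :=
  fun ⟨h, g, g', hF, hG⟩ => ⟨h, g', g, hG, hF⟩

variable (L) in
/-- The Myhill-Nerode equivalence of primitive positive formulas over `T` has finite index. -/
def FiniteIndex (T : Type w) [L.Structure T] : Prop :=
  ∀ n, ∃ (τ : Type) (_ : Finite τ) (t : Finset (Fact L (Fin n ⊕ ℕ)) → τ),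
    ∀ F F', t F = t F' → ∀ A, JointlySat T F A → JointlySat T F' A

/-! ### Positive types in a generic structure. -/

section Generic

variable {T : Type w} [L.Structure T] [L.Structure ℕ] (hT : IsGeneric (L := L) T)
include hT

theorem IsGeneric.jointlySat {n : ℕ} {d : Fin n → ℕ} {F G : Finset (Fact L (Fin n ⊕ ℕ))}
    (hF : F ∈ ppType d) (hG : G ∈ ppType d) : JointlySat T F G := by
  classical
  obtain ⟨g, hg⟩ := hF
  obtain ⟨g', hg'⟩ := hG
  obtain ⟨h, hh⟩ := hT.consistent
    (F.image (Fact.map (Sum.elim d g)) ∪ G.image (Fact.map (Sum.elim d g'))) (by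
      rw [sat_union, sat_image, sat_image]
      exact ⟨hg, hg'⟩)
  rw [sat_union, sat_image, sat_image, Sum.comp_elim, Sum.comp_elim] at hh
  exact ⟨_, _, _, hh⟩

/-- A finite set `s` of true facts is itself a pp formula true at `d`, once the entries of `d` are
read as free variables and all other elements as bound ones. Compatibility of `F` with `s` over `T`
is thus a case of joint satisfiability, and genericity applies. -/
theorem IsGeneric.exists_sat {n : ℕ} {d : Fin n → ℕ} (hd : Function.Injective d)
    {F : Finset (Fact L (Fin n ⊕ ℕ))} (hF : ∀ G ∈ ppType d, JointlySat T F G) (N : ℕ) :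
    ∃ g : ℕ → ℕ, (∀ x, N ≤ g x) ∧ Sat F (Sum.elim d g) := by
  classical
  obtain ⟨g, hg, hgF⟩ := hT.realize (F.image (Fact.map (Sum.map d id))) N (by
    intro s hs
    -- Injectivity of `d` makes the chosen index the right one, so that `σ` inverts `d` on its
    -- range.
    let σ : ℕ → Fin n ⊕ ℕ := fun x => if h : ∃ i, d i = x then .inl h.choose else .inr x
    have hσd : ∀ i, σ (d i) = .inl i := fun i => by
      have h : ∃ j, d j = d i := ⟨i, rfl⟩
      simp only [σ, dif_pos h]
      exact congrArg _ (hd h.choose_spec)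
    have hσ : (Sum.elim d id) ∘ σ = id := by
      funext x
      by_cases h : ∃ i, d i = x
      · obtain ⟨i, rfl⟩ := h
        simp [hσd]
      · simp [σ, dif_neg h]
    obtain ⟨h, g, g', h1, h2⟩ := hF (s.image (Fact.map σ)) ⟨id, by rwa [sat_image, hσ]⟩
    rw [sat_image] at h2
    refine ⟨_, g, h2, ?_⟩
    rw [sat_image]
    convert h1 using 1
    funext x
    rcases x with i | x <;> simp [hσd])
  rw [sat_image] at hgF
  exact ⟨g, hg, by simpa [Sum.elim_comp_map] using hgF⟩

/-- Maximality: a formula true at `d` is jointly satisfiable with everything in the smaller type,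
hence holds at `d'` by `exists_sat`. -/
theorem IsGeneric.eq_of_subset {n : ℕ} {d d' : Fin n → ℕ}
    (h : ppType (L := L) d' ⊆ ppType d) (hd' : Function.Injective d') :
    ppType (L := L) d' = ppType d := by
  refine h.antisymm fun F hF => ?_
  obtain ⟨g, -, hg⟩ := hT.exists_sat hd' (F := F) (fun G hG => hT.jointlySat hF (h hG)) 0
  exact ⟨g, hg⟩

/-- The forth step. One representative of each class met by the type of `(d, c)` gives finitely many
formulas. Their conjunction, with the last variable quantified, is a pp formula true at `d`, hence
at `d'`, and provides `c'`. Any `A` true at `(d', c')` is jointly satisfiable with all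
representatives, therefore with the whole type of `(d, c)`, so `A` holds at `(d, c)`; maximality
turns this inclusion into equality. -/
theorem IsGeneric.exists_extension [Countable (Σ k : ℕ, L.Relations k)]
    (hfin : FiniteIndex L T) {n : ℕ} {d d' : Fin n → ℕ}
    (hd : Function.Injective d) (hd' : Function.Injective d')
    (hdd' : ppType (L := L) d = ppType d') {c : ℕ} (hc : c ∉ Set.range d) :
    ∃ c' ∉ Set.range d', ppType (L := L) (Fin.snoc d c : Fin (n + 1) → ℕ) =
      ppType (Fin.snoc d' c' : Fin (n + 1) → ℕ) := by
  classical
  obtain ⟨τ, _, t, ht⟩ := hfin (n + 1)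
  let ι := t '' ppType (L := L) (Fin.snoc d c : Fin (n + 1) → ℕ)
  have hrep : ∀ v : ι, ∃ F ∈ ppType (Fin.snoc d c : Fin (n + 1) → ℕ), t F = v := fun v => v.2
  choose rep hrep ht_rep using hrep
  have := Fintype.ofFinite ι
  choose g hg using hrep
  obtain ⟨code, hcode⟩ := exists_injective_nat ι
  -- The conjunction of the representatives; pairing with `code v` keeps their bound variables
  -- apart.
  let F : Finset (Fact L (Fin (n + 1) ⊕ ℕ)) :=
    Finset.univ.biUnion fun v => (rep v).image (Fact.map (Sum.map id (Nat.pair (code v))))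
  have hF : ∀ (e : Fin (n + 1) → ℕ) (G : ℕ → ℕ), Sat F (Sum.elim e G) ↔
      ∀ v, Sat (rep v) (Sum.elim e (G ∘ Nat.pair (code v))) := by
    intro e G
    simp only [F, sat_biUnion, sat_image, Finset.mem_univ, true_imp_iff, Sum.elim_comp_map,
      Function.comp_id]
  -- Quantifies the last free variable: it becomes bound variable `0`, and the others shift by one.
  let ρ : Fin (n + 1) ⊕ ℕ → Fin n ⊕ ℕ :=
    Sum.elim (Fin.snoc (α := fun _ => Fin n ⊕ ℕ) Sum.inl (.inr 0)) (Sum.inr ∘ Nat.succ)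
  have hρ : ∀ (d : Fin n → ℕ) (G : ℕ → ℕ),
      Sum.elim d G ∘ ρ = Sum.elim (Fin.snoc (α := fun _ => ℕ) d (G 0)) (G ∘ Nat.succ) := by
    intro d G
    rw [Sum.comp_elim, Fin.comp_snoc]
    rfl
  let G : ℕ → ℕ := fun x => Nat.casesOn x c fun x =>
    Function.extend code g (fun _ _ => 0) (Nat.unpair x).1 (Nat.unpair x).2
  have hmem : F.image (Fact.map ρ) ∈ ppType d := by
    refine ⟨G, ?_⟩
    rw [sat_image, hρ, hF]
    intro v
    have hG : (G ∘ Nat.succ) ∘ Nat.pair (code v) = g v := by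
      funext x
      change Function.extend code g (fun _ _ => 0) (Nat.unpair (Nat.pair (code v) x)).1
        (Nat.unpair (Nat.pair (code v) x)).2 = g v x
      rw [Nat.unpair_pair, hcode.extend_apply]
    rw [hG]
    exact hg v
  rw [hdd'] at hmem
  obtain ⟨m, hm⟩ : ∃ m, ∀ i, d' i < m :=
    ⟨Finset.univ.sup d' + 1, fun i => Nat.lt_succ_of_le (Finset.le_sup (Finset.mem_univ i))⟩
  -- The formula already holds at `d'`; `exists_sat` is used to get witnesses from `m` on, which
  -- avoid the range of `d'`.
  obtain ⟨G', hG', hsat⟩ := hT.exists_sat hd' (F := F.image (Fact.map ρ))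
    (fun A hA => hT.jointlySat hmem hA) m
  rw [sat_image, hρ, hF] at hsat
  have hc' : G' 0 ∉ Set.range d' := by
    rintro ⟨i, hi⟩
    have := hm i
    have := hG' 0
    omega
  refine ⟨G' 0, hc', (hT.eq_of_subset (fun A hA => ?_)
    (Fin.snoc_injective_iff.2 ⟨hd', hc'⟩)).symm⟩
  obtain ⟨g, -, hg⟩ := hT.exists_sat (Fin.snoc_injective_iff.2 ⟨hd, hc⟩) (F := A)
    (fun B hB => by
      have h := hT.jointlySat ⟨_, hsat ⟨t B, B, hB, rfl⟩⟩ hA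
      exact (ht _ _ (ht_rep ⟨t B, B, hB, rfl⟩) A h).symm) 0
  exact ⟨g, hg⟩

theorem IsGeneric.finitelyManyTypes [L.IsRelational] [Countable (Σ k : ℕ, L.Relations k)]
    (hfin : FiniteIndex L T) : FinitelyManyTypes L ℕ := by
  classical
  intro n
  -- Maximality concerns injective tuples only, so a tuple is split into an equality pattern `f` and
  -- an injective enumeration `d`.
  let E : ∀ n, (Fin n → ℕ) → (Fin n → ℕ) → Prop := fun n b b' =>
    ∃ (m : ℕ) (d d' : Fin m → ℕ) (f : Fin n → Fin m), Function.Injective d ∧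
      Function.Injective d' ∧ b = d ∘ f ∧ b' = d' ∘ f ∧ ppType (L := L) d = ppType d'
  have hE : ∀ {n} {b b' : Fin n → ℕ}, E n b b' → SameType L b b' := by
    refine fun {n} {b} {b'} h => sameType_of_backAndForth E ?_ ?_ ?_ ?_ h
    · rintro n _ _ ⟨m, d, d', f, hd, hd', rfl, rfl, h⟩
      exact ⟨m, d', d, f, hd', hd, rfl, rfl, h.symm⟩
    · rintro n _ _ ⟨m, d, d', f, hd, hd', rfl, rfl, h⟩ i j hij
      exact congrArg d' (hd hij)
    · rintro n _ _ ⟨m, d, d', f, hd, hd', rfl, rfl, h⟩ k R x hx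
      have : ({⟨⟨k, R⟩, fun i => .inl (f (x i))⟩} : Finset (Fact L (Fin m ⊕ ℕ))) ∈ ppType d :=
        ⟨id, fun _ hF => by rw [Finset.mem_singleton.1 hF]; exact hx⟩
      rw [h] at this
      obtain ⟨g, hg⟩ := this
      exact hg _ (Finset.mem_singleton_self _)
    · rintro n _ _ ⟨m, d, d', f, hd, hd', rfl, rfl, h⟩ c
      by_cases hc : c ∈ Set.range d
      · obtain ⟨i, rfl⟩ := hc
        exact ⟨d' i, m, d, d', Fin.snoc (α := fun _ => Fin m) f i, hd, hd',
          (Fin.comp_snoc _ _ _).symm, (Fin.comp_snoc _ _ _).symm, h⟩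
      · obtain ⟨c', hc', h'⟩ := hT.exists_extension hfin hd hd' h hc
        refine ⟨c', m + 1, Fin.snoc d c, Fin.snoc d' c',
          Fin.snoc (α := fun _ => Fin (m + 1)) (Fin.castSucc ∘ f) (Fin.last m),
          Fin.snoc_injective_iff.2 ⟨hd, hc⟩, Fin.snoc_injective_iff.2 ⟨hd', hc'⟩, ?_, ?_, h'⟩
        · rw [Fin.comp_snoc]
          simp [← Function.comp_assoc, Fin.snoc_comp_castSucc]
        · rw [Fin.comp_snoc]
          simp [← Function.comp_assoc, Fin.snoc_comp_castSucc]
  choose τ hτ t ht using hfin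
  -- The finite invariant of a tuple: the number of its distinct entries, its equality pattern, and
  -- the classes met by its pp type.
  let Q : (Σ m : Fin (n + 1), (Fin n → Fin m) × Set (τ m)) → (Fin n → ℕ) → Prop := fun x b =>
    ∃ d : Fin x.1 → ℕ, Function.Injective d ∧ b = d ∘ x.2.1 ∧ t x.1 '' ppType d = x.2.2
  have hQ : ∀ b, ∃ x, Q x b := by
    intro b
    let s := Finset.univ.image b
    have hs : s.card < n + 1 :=
      Nat.lt_succ_of_le (Finset.card_image_le.trans (by simp))
    let e : s ≃ Fin s.card := s.equivFin
    exact ⟨⟨⟨s.card, hs⟩, fun j => e ⟨b j, Finset.mem_image_of_mem _ (Finset.mem_univ j)⟩,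
      t s.card '' ppType fun i => (e.symm i).1⟩, fun i => (e.symm i).1, Subtype.val_injective.comp e.symm.injective,
      by funext j; simp, rfl⟩
  choose g hg using hQ
  refine ⟨_, inferInstance, g, fun b b' h => hE ?_⟩
  obtain ⟨d, hd, hb, hd₁⟩ := hg b
  obtain ⟨d', hd', hb', hd₁'⟩ := h ▸ hg b'
  -- A formula equivalent to one true at `d'` is jointly satisfiable with the whole type of `d'`,
  -- hence true there.
  have key : ∀ {m} {d d' : Fin m → ℕ}, Function.Injective d' →
      t m '' ppType d = t m '' ppType d' → ppType (L := L) d ⊆ ppType d' := by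
    intro m d d' hd' h F hF
    obtain ⟨F', hF', hFF'⟩ : t m F ∈ t m '' ppType d' := h ▸ ⟨F, hF, rfl⟩
    obtain ⟨g, -, hg⟩ := hT.exists_sat hd' (F := F)
      (fun G hG => ht m _ _ hFF' G (hT.jointlySat hF' hG)) 0
    exact ⟨g, hg⟩
  have hdd' := hd₁.trans hd₁'.symm
  exact ⟨_, d, d', _, hd, hd', hb, hb', (key hd' hdd').antisymm (key hd hdd'.symm)⟩

/-- The facts of a finite structure form a finite set. Without parameters, it is compatible with
every finite part of `ℕ` once it is satisfiable in `T`, so it is realised; conversely its image in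
`ℕ` is a finite part and maps to `T`. -/
theorem IsGeneric.csp_eq [L.IsRelational] [Finite (Σ k : ℕ, L.Relations k)] [Nonempty T] :
    Csp L T = Csp L ℕ := by
  classical
  ext A
  have hfacts : {f : Fact L A.carrier | Structure.RelMap f.1.2 f.2}.Finite := Set.toFinite _
  let F := hfacts.toFinset
  have hF : ∀ {k} (R : L.Relations k) (x : Fin k → A.carrier), Structure.RelMap R x →
      (⟨⟨k, R⟩, x⟩ : Fact L A.carrier) ∈ F := fun R x h => by simpa [F] using h
  constructor
  · rintro ⟨φ⟩
    obtain ⟨code, hcode⟩ := exists_injective_nat A.carrier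
    obtain ⟨g, -, hg⟩ := hT.realize (F.image (Fact.map (Sum.inr ∘ code))) 0 (by
      intro s hs
      obtain ⟨h, hh⟩ := hT.consistent s hs
      refine ⟨h, Function.extend code φ fun _ => Classical.arbitrary T, hh, ?_⟩
      rw [sat_image]
      intro f hf
      have := φ.map_rel f.1.2 f.2 (by simpa [F] using hf)
      convert this using 1
      funext i
      simp [hcode.extend_apply])
    rw [sat_image] at hg
    exact ⟨⟨g ∘ code, fun f => isEmptyElim f, fun R x h => hg _ (hF R x h)⟩⟩
  · rintro ⟨φ⟩
    obtain ⟨h, hh⟩ := hT.consistent (F.image (Fact.map φ)) (by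
      rw [sat_image]
      intro f hf
      exact φ.map_rel f.1.2 f.2 (by simpa [F] using hf))
    rw [sat_image] at hh
    exact ⟨⟨h ∘ φ, fun f => isEmptyElim f, fun R x hx => hh _ (hF R x hx)⟩⟩

end Generic

end Facts

end GSOCsp

namespace GSOCsp

open FirstOrder FirstOrder.Language

/-! ### The composition method for guarded semantics along free amalgams. -/

section Amalgam

variable {L : FirstOrder.Language.{u, v}}

/-- `D` is the free amalgam of `A` and `B` over the elements labelled by `a` and `b`. -/
structure IsFreeAmalgam {A B D : Type*} [L.Structure A] [L.Structure B] [L.Structure D] {n : ℕ}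
    (a : Fin n → A) (b : Fin n → B) (i : A → D) (j : B → D) : Prop where
  injective_left : Function.Injective i
  injective_right : Function.Injective j
  eq_iff : ∀ x y, i x = j y ↔ ∃ l, a l = x ∧ b l = y
  cover : ∀ z, (∃ x, i x = z) ∨ ∃ y, j y = z
  relMap_iff : ∀ {k} (R : L.Relations k) (t : Fin k → D), Structure.RelMap R t ↔
    t ∈ (fun u => i ∘ u) '' {u | Structure.RelMap R u} ∪
      (fun u => j ∘ u) '' {u | Structure.RelMap R u}

variable (L) in
/-- A labelled structure with a partial assignment of the first-order variables and an
assignment of the second-order variables. -/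
structure Config (n : ℕ) where
  carrier : Type
  [str : L.Structure carrier]
  label : Fin n → carrier
  asg : ℕ → Option carrier
  rels : ∀ X : RelVar, Set (Fin X.arity → carrier)

attribute [instance] Config.str

/-- Updating the value of a first-order variable. -/
def Config.setVar {n : ℕ} (c : Config L n) (x : ℕ) (o : Option c.carrier) : Config L n :=
  { c with asg := Function.update c.asg x o }

/-- Updating the value of a second-order variable. -/
def Config.setRel {n : ℕ} (c : Config L n) (X : RelVar) (R : Set (Fin X.arity → c.carrier)) :
    Config L n :=
  { c with rels := Function.update c.rels X R }

section Glue

variable {A B D : Type*} (i : A → D) (j : B → D)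

/-- The assignment in the amalgam given by a partial assignment on the left and an assignment
on the right. -/
def glueAsg (s : ℕ → Option A) (s' : ℕ → B) : ℕ → D := fun x => (s x).elim (j (s' x)) i

/-- The relations in the amalgam given by relations on both sides. -/
def glueRels (S : ∀ X : RelVar, Set (Fin X.arity → A)) (S' : ∀ X : RelVar, Set (Fin X.arity → B)) :
    ∀ X : RelVar, Set (Fin X.arity → D) :=
  fun X => (fun u => i ∘ u) '' S X ∪ (fun u => j ∘ u) '' S' X

theorem glueAsg_update (s : ℕ → Option A) (s' : ℕ → B) (x : ℕ) (o : Option A) (y : B) :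
    glueAsg i j (Function.update s x o) (Function.update s' x y) =
      Function.update (glueAsg i j s s') x (o.elim (j y) i) := by
  funext z
  by_cases h : z = x
  · subst h
    simp [glueAsg]
  · simp [glueAsg, h]

theorem glueRels_update (S : ∀ X : RelVar, Set (Fin X.arity → A))
    (S' : ∀ X : RelVar, Set (Fin X.arity → B)) (X : RelVar) (R : Set (Fin X.arity → A))
    (R' : Set (Fin X.arity → B)) :
    glueRels i j (Function.update S X R) (Function.update S' X R') =
      Function.update (glueRels i j S S') X ((fun u => i ∘ u) '' R ∪ (fun u => j ∘ u) '' R') := by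
  funext Y
  by_cases h : Y = X
  · subst h
    simp [glueRels]
  · simp [glueRels, h]

end Glue

variable {n : ℕ}

/-- The type of a tuple of variables with respect to a relation on the left-hand side. -/
def Config.tupleType (c : Config L n) {k : ℕ} (x : Fin k → ℕ) (R : Set (Fin k → c.carrier)) :
    (Fin k → Option (Set (Fin n))) × Set (Fin k → Option (Fin n)) :=
  (fun m => (c.asg (x m)).map fun v => {l | c.label l = v},
    {e | ∃ u ∈ R, ∀ m, (e m).elim (c.asg (x m) = some (u m)) fun l => c.label l = u m})

section Transfer

variable {B D D' : Type} [L.Structure B] [L.Structure D] [L.Structure D'] {b : Fin n → B}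

theorem Config.kind_none {c c' : Config L n} {x : ℕ}
    (h : ((c.asg x).map fun v => {l | c.label l = v}) =
      (c'.asg x).map fun v => {l | c'.label l = v}) (hx : c.asg x = none) : c'.asg x = none := by
  rw [hx] at h
  simpa using h.symm

theorem Config.kind_some {c c' : Config L n} {x : ℕ}
    (h : ((c.asg x).map fun v => {l | c.label l = v}) =
      (c'.asg x).map fun v => {l | c'.label l = v}) {l : Fin n} (hx : c.asg x = some (c.label l)) :
    c'.asg x = some (c'.label l) := by
  rw [hx] at h
  obtain ⟨v, hv, hv'⟩ := Option.map_eq_some_iff.1 h.symm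
  have : l ∈ {l | c'.label l = v} := hv' ▸ (rfl : c.label l = c.label l)
  rw [hv, show c'.label l = v from this]

/-- Suppose the glued tuple comes from a tuple `u` of the left relation. A variable valued on the
left has value `u m` itself; one valued on the right must meet the left side at a label. The pattern
`e` records `none` in the first case and the label in the second, and an equal `tupleType` provides
a tuple of `R'` with the same pattern. For tuples from the right, only the labels attached to left
values matter. -/
theorem Config.tupleType_transfer {c c' : Config L n} {i : c.carrier → D} {j : B → D}
    {i' : c'.carrier → D'} {j' : B → D'} (hD : IsFreeAmalgam (L := L) c.label b i j)
    (hD' : IsFreeAmalgam (L := L) c'.label b i' j') {k : ℕ} {x : Fin k → ℕ}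
    {R : Set (Fin k → c.carrier)} {R' : Set (Fin k → c'.carrier)}
    (h : c.tupleType x R = c'.tupleType x R') (s : ℕ → B) (Q : Set (Fin k → B))
    (hx : (fun m => glueAsg i j c.asg s (x m)) ∈ (fun u => i ∘ u) '' R ∪ (fun u => j ∘ u) '' Q) :
    (fun m => glueAsg i' j' c'.asg s (x m)) ∈ (fun u => i' ∘ u) '' R' ∪ (fun u => j' ∘ u) '' Q := by
  obtain ⟨h1, h2⟩ := Prod.mk.inj h
  replace h1 := fun m => congrFun h1 m
  rcases hx with ⟨u, hu, hux⟩ | ⟨w, hw, hwx⟩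
  · have hm : ∀ m, ∃ e : Option (Fin n),
        (e.elim (c.asg (x m) = some (u m)) fun l => c.label l = u m) ∧
        ∀ l, e = some l → c.asg (x m) = none ∧ b l = s (x m) := by
      intro m
      have := congrFun hux m
      simp only [Function.comp_apply, glueAsg] at this
      cases hv : c.asg (x m) with
      | none =>
        rw [hv] at this
        obtain ⟨l, hl, hl'⟩ := (hD.eq_iff _ _).1 this
        exact ⟨some l, hl, fun l' h => by cases h; exact ⟨rfl, hl'⟩⟩
      | some v =>
        rw [hv] at this
        exact ⟨none, congrArg some (hD.injective_left this).symm, fun l h => by cases h⟩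
    choose e he he' using hm
    have : e ∈ {e : Fin k → Option (Fin n) | ∃ u ∈ R', ∀ m,
        (e m).elim (c'.asg (x m) = some (u m)) fun l => c'.label l = u m} := h2 ▸ ⟨u, hu, he⟩
    obtain ⟨u', hu', hm'⟩ := this
    refine Or.inl ⟨u', hu', ?_⟩
    funext m
    have hm := hm' m
    simp only [Function.comp_apply, glueAsg]
    cases hv : e m with
    | none =>
      rw [hv] at hm
      rw [show c'.asg (x m) = some (u' m) from hm]
      rfl
    | some l =>
      rw [hv] at hm
      obtain ⟨h3, h4⟩ := he' m l hv
      rw [Config.kind_none (h1 m) h3]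
      exact (hD'.eq_iff _ _).2 ⟨l, hm, h4⟩
  · refine Or.inr ⟨w, hw, ?_⟩
    funext m
    have := congrFun hwx m
    simp only [Function.comp_apply, glueAsg] at this ⊢
    cases hv : c.asg (x m) with
    | none =>
      rw [hv] at this
      rw [Config.kind_none (h1 m) hv]
      exact congrArg j' (hD.injective_right this)
    | some v =>
      rw [hv] at this
      obtain ⟨l, rfl, hl'⟩ := (hD.eq_iff _ _).1 this.symm
      rw [Config.kind_some (h1 m) hv]
      exact ((hD'.eq_iff _ _).2 ⟨l, rfl, hl'⟩).symm

theorem Config.eq_transfer {c c' : Config L n} {i : c.carrier → D} {j : B → D}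
    {i' : c'.carrier → D'} {j' : B → D'} (hD : IsFreeAmalgam (L := L) c.label b i j)
    (hD' : IsFreeAmalgam (L := L) c'.label b i' j') {x y : ℕ}
    (hx : ((c.asg x).map fun v => {l | c.label l = v}) =
      (c'.asg x).map fun v => {l | c'.label l = v})
    (hy : ((c.asg y).map fun v => {l | c.label l = v}) =
      (c'.asg y).map fun v => {l | c'.label l = v})
    (hxy : c.asg x = c.asg y → c'.asg x = c'.asg y) (s : ℕ → B)
    (h : glueAsg i j c.asg s x = glueAsg i j c.asg s y) :
    glueAsg i' j' c'.asg s x = glueAsg i' j' c'.asg s y := by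
  unfold glueAsg at h ⊢
  cases hvx : c.asg x with
  | none =>
    rw [Config.kind_none hx hvx]
    rw [hvx] at h
    cases hvy : c.asg y with
    | none =>
      rw [Config.kind_none hy hvy]
      rw [hvy] at h
      exact congrArg j' (hD.injective_right h)
    | some v =>
      rw [hvy] at h
      obtain ⟨l, rfl, hl⟩ := (hD.eq_iff _ _).1 h.symm
      rw [Config.kind_some hy hvy]
      exact ((hD'.eq_iff _ _).2 ⟨l, rfl, hl⟩).symm
  | some v =>
    cases hvy : c.asg y with
    | none =>
      rw [hvx, hvy] at h
      obtain ⟨l, rfl, hl⟩ := (hD.eq_iff _ _).1 h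
      rw [Config.kind_none hy hvy, Config.kind_some hx hvx]
      exact (hD'.eq_iff _ _).2 ⟨l, rfl, hl⟩
    | some v' =>
      rw [hvx, hvy] at h
      have hcc' := hxy (by rw [hvx, hvy, hD.injective_left h])
      rw [← hcc']
      have : (c'.asg x).isSome := by
        have := congrArg Option.isSome hx
        simpa [hvx] using this.symm
      obtain ⟨z, hz⟩ := Option.isSome_iff_exists.1 this
      rw [hz]
      rfl

end Transfer

section Guarded

variable {A B D : Type*} [L.Structure A] [L.Structure B] [L.Structure D]
  {a : Fin n → A} {b : Fin n → B} {i : A → D} {j : B → D}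

theorem IsFreeAmalgam.isGuardedTuple_left (hD : IsFreeAmalgam (L := L) a b i j) {k : ℕ}
    {t : Fin k → A} (ht : IsGuardedTuple L t) : IsGuardedTuple L (i ∘ t) := by
  rcases ht with ⟨x, hx⟩ | ⟨m, R, u, hu, htu⟩
  · exact Or.inl ⟨i x, by rw [Set.range_comp]; simpa using Set.image_mono (f := i) hx⟩
  · refine Or.inr ⟨m, R, i ∘ u, (hD.relMap_iff R _).2 (Or.inl ⟨u, hu, rfl⟩), ?_⟩
    rw [Set.range_comp, Set.range_comp]
    exact Set.image_mono htu

theorem IsFreeAmalgam.isGuardedTuple_right (hD : IsFreeAmalgam (L := L) a b i j) {k : ℕ}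
    {t : Fin k → B} (ht : IsGuardedTuple L t) : IsGuardedTuple L (j ∘ t) := by
  rcases ht with ⟨x, hx⟩ | ⟨m, R, u, hu, htu⟩
  · exact Or.inl ⟨j x, by rw [Set.range_comp]; simpa using Set.image_mono (f := j) hx⟩
  · refine Or.inr ⟨m, R, j ∘ u, (hD.relMap_iff R _).2 (Or.inr ⟨u, hu, rfl⟩), ?_⟩
    rw [Set.range_comp, Set.range_comp]
    exact Set.image_mono htu

theorem exists_lift_of_range_subset {α β : Type*} {f : α → β} {k : ℕ} {t : Fin k → β} {s : Set α}
    (h : Set.range t ⊆ f '' s) : ∃ t', f ∘ t' = t ∧ Set.range t' ⊆ s := by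
  have : ∀ m, ∃ x ∈ s, f x = t m := fun m => h ⟨m, rfl⟩
  choose t' ht' ht using this
  exact ⟨t', funext ht, by rintro _ ⟨m, rfl⟩; exact ht' m⟩

theorem IsFreeAmalgam.exists_of_isGuardedTuple (hD : IsFreeAmalgam (L := L) a b i j) {k : ℕ}
    {t : Fin k → D} (ht : IsGuardedTuple L t) :
    (∃ t', i ∘ t' = t ∧ IsGuardedTuple L t') ∨ ∃ t', j ∘ t' = t ∧ IsGuardedTuple L t' := by
  rcases ht with ⟨z, hz⟩ | ⟨m, R, u, hu, htu⟩
  · rcases hD.cover z with ⟨x, rfl⟩ | ⟨y, rfl⟩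
    · obtain ⟨t', ht', h⟩ := exists_lift_of_range_subset (f := i) (s := {x}) (by simpa using hz)
      exact Or.inl ⟨t', ht', Or.inl ⟨x, h⟩⟩
    · obtain ⟨t', ht', h⟩ := exists_lift_of_range_subset (f := j) (s := {y}) (by simpa using hz)
      exact Or.inr ⟨t', ht', Or.inl ⟨y, h⟩⟩
  · rcases (hD.relMap_iff R u).1 hu with ⟨w, hw, rfl⟩ | ⟨w, hw, rfl⟩
    · obtain ⟨t', ht', h⟩ := exists_lift_of_range_subset (f := i) (t := t) (s := Set.range w)
        (by rw [← Set.range_comp]; exact htu)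
      exact Or.inl ⟨t', ht', Or.inr ⟨m, R, w, hw, h⟩⟩
    · obtain ⟨t', ht', h⟩ := exists_lift_of_range_subset (f := j) (t := t) (s := Set.range w)
        (by rw [← Set.range_comp]; exact htu)
      exact Or.inr ⟨t', ht', Or.inr ⟨m, R, w, hw, h⟩⟩

/-- Every atom satisfied in the amalgam comes from one side, so each guarded tuple does too. This
lets a second-order quantifier split into independent choices on the two sides. -/
theorem IsFreeAmalgam.isGuardedRel_iff (hD : IsFreeAmalgam (L := L) a b i j) {k : ℕ}
    {R : Set (Fin k → D)} : IsGuardedRel L k R ↔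
      ∃ (P : Set (Fin k → A)) (Q : Set (Fin k → B)), IsGuardedRel L k P ∧ IsGuardedRel L k Q ∧
        R = (fun u => i ∘ u) '' P ∪ (fun u => j ∘ u) '' Q := by
  constructor
  · intro hR
    refine ⟨{t | i ∘ t ∈ R ∧ IsGuardedTuple L t}, {t | j ∘ t ∈ R ∧ IsGuardedTuple L t},
      fun t ht => ht.2, fun t ht => ht.2, Set.Subset.antisymm (fun t ht => ?_) ?_⟩
    · rcases hD.exists_of_isGuardedTuple (hR t ht) with ⟨t', rfl, ht'⟩ | ⟨t', rfl, ht'⟩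
      · exact Or.inl ⟨t', ⟨ht, ht'⟩, rfl⟩
      · exact Or.inr ⟨t', ⟨ht, ht'⟩, rfl⟩
    · rintro _ (⟨t, ht, rfl⟩ | ⟨t, ht, rfl⟩)
      · exact ht.1
      · exact ht.1
  · rintro ⟨P, Q, hP, hQ, rfl⟩ _ (⟨t, ht, rfl⟩ | ⟨t, ht, rfl⟩)
    · exact hD.isGuardedTuple_left (hP t ht)
    · exact hD.isGuardedTuple_right (hQ t ht)

end Guarded

/-- The truth of `φ` in free amalgams, under guarded semantics, depends on the left-hand side
only through its value under `t`. -/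
def Determines {τ : Type*} (t : Config L n → τ) (φ : SOFormula L) : Prop :=
  ∀ c c' : Config L n, t c = t c' →
    ∀ {B D D' : Type} [L.Structure B] [L.Structure D] [L.Structure D'] (b : Fin n → B)
      (i : c.carrier → D) (j : B → D) (i' : c'.carrier → D') (j' : B → D'),
      IsFreeAmalgam (L := L) c.label b i j → IsFreeAmalgam (L := L) c'.label b i' j' →
      ∀ (s : ℕ → B) (S : ∀ X : RelVar, Set (Fin X.arity → B)),
        φ.Realize (IsGuardedRel L) (glueAsg i j c.asg s) (glueRels i j c.rels S) →
        φ.Realize (IsGuardedRel L) (glueAsg i' j' c'.asg s) (glueRels i' j' c'.rels S)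

variable (n) in
/-- The truth of `φ` in free amalgams is determined by finitely much information about the
left-hand side. -/
def Composes (φ : SOFormula L) : Prop :=
  ∃ (τ : Type) (_ : Finite τ) (t : Config L n → τ), Determines t φ

theorem Composes.congr {φ ψ : SOFormula L} (h : Composes n φ)
    (hφ : ∀ {A : Type} [L.Structure A] (s : ℕ → A) (S : ∀ X : RelVar, Set (Fin X.arity → A)),
      φ.Realize (IsGuardedRel L) s S ↔ ψ.Realize (IsGuardedRel L) s S) : Composes n ψ := by
  obtain ⟨τ, hτ, t, ht⟩ := h
  refine ⟨τ, hτ, t, fun c c' h B D D' _ _ _ b i j i' j' hD hD' s S hs => ?_⟩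
  exact (hφ _ _).1 (ht c c' h b i j i' j' hD hD' s S ((hφ _ _).2 hs))

theorem Composes.not {φ : SOFormula L} (h : Composes n φ) : Composes n φ.not := by
  obtain ⟨τ, hτ, t, ht⟩ := h
  exact ⟨τ, hτ, t, fun c c' h B D D' _ _ _ b i j i' j' hD hD' s S hs hs' =>
    hs (ht c' c h.symm b i' j' i j hD' hD s S hs')⟩

theorem Composes.and {φ ψ : SOFormula L} (hφ : Composes n φ) (hψ : Composes n ψ) :
    Composes n (φ.and ψ) := by
  obtain ⟨τ, hτ, t, ht⟩ := hφ
  obtain ⟨τ', hτ', t', ht'⟩ := hψ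
  refine ⟨τ × τ', inferInstance, fun c => (t c, t' c),
    fun c c' h B D D' _ _ _ b i j i' j' hD hD' s S hs => ?_⟩
  exact ⟨ht c c' (congrArg Prod.fst h) b i j i' j' hD hD' s S hs.1,
    ht' c c' (congrArg Prod.snd h) b i j i' j' hD hD' s S hs.2⟩

/-- The value `none` stands for a witness chosen on the right. What matters about the left side is
the set of invariants reachable by some choice, and a set of elements of a finite type is again
finite information. -/
theorem Composes.ex {φ : SOFormula L} (x : ℕ) (h : Composes n φ) : Composes n (φ.ex x) := by
  obtain ⟨τ, hτ, t, ht⟩ := h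
  refine ⟨Set τ, inferInstance, fun c => Set.range fun o => t (c.setVar x o),
    fun c c' h B D D' _ _ _ b i j i' j' hD hD' s S ⟨z, hz⟩ => ?_⟩
  obtain ⟨o, y, rfl⟩ : ∃ (o : Option c.carrier) (y : B), o.elim (j y) i = z := by
    rcases hD.cover z with ⟨x', rfl⟩ | ⟨y, rfl⟩
    -- The right component is a filler, overridden by the value on the left.
    · exact ⟨some x', s x, rfl⟩
    · exact ⟨none, y, rfl⟩
  obtain ⟨o', ho'⟩ : t (c.setVar x o) ∈ Set.range fun o => t (c'.setVar x o) :=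
    (Set.ext_iff.1 h _).1 ⟨o, rfl⟩
  rw [← glueAsg_update] at hz
  have := ht (c.setVar x o) (c'.setVar x o') ho'.symm b i j i' j' hD hD' _ S hz
  exact ⟨o'.elim (j' y) i', by rw [← glueAsg_update]; exact this⟩

theorem Composes.exRel {φ : SOFormula L} (X : RelVar) (h : Composes n φ) :
    Composes n (φ.exRel X) := by
  obtain ⟨τ, hτ, t, ht⟩ := h
  refine ⟨Set τ, inferInstance,
    fun c => (fun R => t (c.setRel X R)) '' {R | IsGuardedRel L X.arity R},
    fun c c' h B D D' _ _ _ b i j i' j' hD hD' s S ⟨R, hR, hRφ⟩ => ?_⟩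
  obtain ⟨P, Q, hP, hQ, rfl⟩ := hD.isGuardedRel_iff.1 hR
  obtain ⟨P', hP', hPP'⟩ : t (c.setRel X P) ∈
      (fun R => t (c'.setRel X R)) '' {R | IsGuardedRel L X.arity R} :=
    (Set.ext_iff.1 h _).1 ⟨P, hP, rfl⟩
  rw [← glueRels_update] at hRφ
  have := ht (c.setRel X P) (c'.setRel X P') hPP'.symm b i j i' j' hD hD' s _ hRφ
  exact ⟨_, hD'.isGuardedRel_iff.2 ⟨P', Q, hP', hQ, rfl⟩, by rw [← glueRels_update]; exact this⟩

variable (n) in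
/-- Every second-order formula under guarded semantics composes along free amalgams. -/
theorem composes (φ : SOFormula L) : Composes n φ := by
  induction φ with
  | eq x y =>
    refine ⟨Option (Set (Fin n)) × Option (Set (Fin n)) × Prop, inferInstance,
      fun c => ((c.asg x).map fun v => {l | c.label l = v},
        (c.asg y).map fun v => {l | c.label l = v}, c.asg x = c.asg y),
      fun c c' h B D D' _ _ _ b i j i' j' hD hD' s S hs => ?_⟩
    simp only [Prod.mk.injEq] at h
    exact Config.eq_transfer hD hD' h.1 h.2.1 (fun hc => h.2.2 ▸ hc) s hs
  | rel R x =>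
    refine ⟨_, inferInstance, fun c => c.tupleType x {u | Structure.RelMap R u},
      fun c c' h B D D' _ _ _ b i j i' j' hD hD' s S hs => ?_⟩
    exact (hD'.relMap_iff R _).2 (Config.tupleType_transfer hD hD' h s _ ((hD.relMap_iff R _).1 hs))
  | app X x =>
    refine ⟨_, inferInstance, fun c => c.tupleType x (c.rels X),
      fun c c' h B D D' _ _ _ b i j i' j' hD hD' s S hs => ?_⟩
    exact Config.tupleType_transfer hD hD' h s _ hs
  | not φ ih => exact ih.not
  | and φ ψ ihφ ihψ => exact ihφ.and ihψ
  | or φ ψ ihφ ihψ =>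
    exact (ihφ.not.and ihψ.not).not.congr fun s S => by simp [SOFormula.Realize]; tauto
  | ex x φ ih => exact ih.ex x
  | all x φ ih => exact (ih.not.ex x).not.congr fun s S => by simp [SOFormula.Realize]
  | exRel X φ ih => exact ih.exRel X
  | allRel X φ ih => exact (ih.not.exRel X).not.congr fun s S => by simp [SOFormula.Realize]

end Amalgam

end GSOCsp

namespace GSOCsp

open FirstOrder FirstOrder.Language

/-! ### Reduction of guarded and monadic formulas to guarded semantics. -/

namespace SOFormula

variable {L : FirstOrder.Language.{u, v}} {A : Type w} [L.Structure A]

/-- The truth of a formula depends only on the values of its free variables. -/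
theorem realize_congr (P : ∀ n : ℕ, Set (Fin n → A) → Prop) (φ : SOFormula L) {s s' : ℕ → A}
    {S S' : ∀ X : RelVar, Set (Fin X.arity → A)} (hs : ∀ x ∈ φ.freeVars, s x = s' x)
    (hS : ∀ X ∈ φ.freeRelVars, S X = S' X) : φ.Realize P s S ↔ φ.Realize P s' S' := by
  induction φ generalizing s s' S S' with
  | eq x y =>
    simp only [Realize]
    rw [hs x (by simp [freeVars]), hs y (by simp [freeVars])]
  | rel R x =>
    simp only [Realize]
    rw [funext fun i => hs (x i) ⟨i, rfl⟩]
  | app X x =>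
    simp only [Realize]
    rw [funext fun i => hs (x i) ⟨i, rfl⟩, hS X rfl]
  | not φ ih => exact not_congr (ih hs hS)
  | and φ ψ ihφ ihψ =>
    exact and_congr (ihφ (fun x hx => hs x (.inl hx)) fun X hX => hS X (.inl hX))
      (ihψ (fun x hx => hs x (.inr hx)) fun X hX => hS X (.inr hX))
  | or φ ψ ihφ ihψ =>
    exact or_congr (ihφ (fun x hx => hs x (.inl hx)) fun X hX => hS X (.inl hX))
      (ihψ (fun x hx => hs x (.inr hx)) fun X hX => hS X (.inr hX))
  | ex x φ ih =>
    refine exists_congr fun a => ih (fun y hy => ?_) hS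
    by_cases h : y = x
    · subst h; simp
    · simpa [h] using hs y ⟨hy, h⟩
  | all x φ ih =>
    refine forall_congr' fun a => ih (fun y hy => ?_) hS
    by_cases h : y = x
    · subst h; simp
    · simpa [h] using hs y ⟨hy, h⟩
  | exRel X φ ih =>
    refine exists_congr fun R => and_congr_right fun _ => ih hs fun Y hY => ?_
    by_cases h : Y = X
    · subst h; simp
    · simpa [h] using hS Y ⟨hY, h⟩
  | allRel X φ ih =>
    refine forall_congr' fun R => imp_congr_right fun _ => ih hs fun Y hY => ?_
    by_cases h : Y = X
    · subst h; simp
    · simpa [h] using hS Y ⟨hY, h⟩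

theorem IsSentence.realize_iff {φ : SOFormula L} (h : φ.IsSentence)
    (P : ∀ n : ℕ, Set (Fin n → A) → Prop) (s s' : ℕ → A)
    (S S' : ∀ X : RelVar, Set (Fin X.arity → A)) : φ.Realize P s S ↔ φ.Realize P s' S' :=
  φ.realize_congr P (by simp [h.1]) (by simp [h.2])

theorem realize_exs (P : ∀ n : ℕ, Set (Fin n → A) → Prop) (φ : SOFormula L) (ys : List ℕ)
    (s : ℕ → A) (S : ∀ X : RelVar, Set (Fin X.arity → A)) :
    (exs ys φ).Realize P s S ↔ ∃ s' : ℕ → A, (∀ x ∉ ys, s' x = s x) ∧ φ.Realize P s' S := by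
  induction ys generalizing s with
  | nil =>
    refine ⟨fun h => ⟨s, fun _ _ => rfl, h⟩, fun ⟨s', hs', h⟩ => ?_⟩
    obtain rfl : s' = s := funext fun x => hs' x (by simp)
    exact h
  | cons y ys ih =>
    change (∃ a, (exs ys φ).Realize P _ S) ↔ _
    simp only [ih]
    constructor
    · rintro ⟨a, s', hs', h⟩
      refine ⟨s', fun x hx => ?_, h⟩
      rw [List.mem_cons, not_or] at hx
      rw [hs' x hx.2, Function.update_of_ne hx.1]
    · rintro ⟨s', hs', h⟩
      refine ⟨s' y, s', fun x hx => ?_, h⟩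
      by_cases hxy : x = y
      · subst hxy; simp
      · rw [Function.update_of_ne hxy]
        exact hs' x (by simp [hxy, hx])

theorem realize_alls (P : ∀ n : ℕ, Set (Fin n → A) → Prop) (φ : SOFormula L) (ys : List ℕ)
    (s : ℕ → A) (S : ∀ X : RelVar, Set (Fin X.arity → A)) :
    (alls ys φ).Realize P s S ↔ ∀ s' : ℕ → A, (∀ x ∉ ys, s' x = s x) → φ.Realize P s' S := by
  have h : (alls ys φ).Realize P s S ↔ ¬ (exs ys φ.not).Realize P s S := by
    induction ys generalizing s with
    | nil => exact not_not.symm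
    | cons y ys ih =>
      change (∀ a, (alls ys φ).Realize P _ S) ↔ ¬ ∃ a, (exs ys φ.not).Realize P _ S
      simp only [ih, not_exists]
  rw [h, realize_exs]
  simp only [Realize, not_exists, not_and, not_not]

/-- The elements of `U` all occur in one satisfied atomic formula. -/
def IsGuardedSet (L : FirstOrder.Language.{u, v}) {A : Type w} [L.Structure A] (U : Set A) : Prop :=
  (∃ a : A, U ⊆ {a}) ∨ ∃ (k : ℕ) (R : L.Relations k) (b : Fin k → A),
    Structure.RelMap R b ∧ U ⊆ Set.range b

theorem IsGuardedSet.mono {U V : Set A} (hV : IsGuardedSet L V) (h : U ⊆ V) : IsGuardedSet L U :=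
  hV.imp (fun ⟨a, ha⟩ => ⟨a, h.trans ha⟩) fun ⟨k, R, b, hb, hV⟩ => ⟨k, R, b, hb, h.trans hV⟩

theorem IsSigAtom.isGuardedSet {α : SOFormula L} (hα : α.IsSigAtom)
    {P : ∀ n : ℕ, Set (Fin n → A) → Prop} {s : ℕ → A} {S : ∀ X : RelVar, Set (Fin X.arity → A)}
    (h : α.Realize P s S) : IsGuardedSet L (s '' α.freeVars) := by
  cases hα with
  | eq x y =>
    refine Or.inl ⟨s x, ?_⟩
    have h : s x = s y := h
    simp [freeVars, Set.image_pair, h]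
  | rel R x =>
    refine Or.inr ⟨_, R, _, h, ?_⟩
    rw [freeVars, ← Set.range_comp]
    rfl

theorem IsSigAtom.realize_iff {α : SOFormula L} (hα : α.IsSigAtom)
    (P P' : ∀ n : ℕ, Set (Fin n → A) → Prop) (s : ℕ → A)
    (S S' : ∀ X : RelVar, Set (Fin X.arity → A)) : α.Realize P s S ↔ α.Realize P' s S' := by
  cases hα <;> exact Iff.rfl

variable (L) in
/-- The guarded tuples of the given relations. -/
def guardedPart (S : ∀ X : RelVar, Set (Fin X.arity → A)) : ∀ X : RelVar, Set (Fin X.arity → A) :=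
  fun X => {t ∈ S X | IsGuardedTuple L t}

theorem guardedPart_update (S : ∀ X : RelVar, Set (Fin X.arity → A)) (X : RelVar)
    (R : Set (Fin X.arity → A)) : guardedPart L (Function.update S X R) =
      Function.update (guardedPart L S) X {t ∈ R | IsGuardedTuple L t} := by
  funext Y
  by_cases h : Y = X
  · subst h; simp [guardedPart]
  · simp [guardedPart, h]

/-- Syntactically guarded formulas cannot distinguish relations with the same guarded tuples. -/
theorem IsGuarded.realize_iff {φ : SOFormula L} (hφ : φ.IsGuarded) {s : ℕ → A}
    {S : ∀ X : RelVar, Set (Fin X.arity → A)} (hs : IsGuardedSet L (s '' φ.freeVars)) :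
    φ.Realize (fun _ _ => True) s S ↔ φ.Realize (IsGuardedRel L) s (guardedPart L S) := by
  induction hφ generalizing s S with
  | eq x y => exact Iff.rfl
  | rel R x => exact Iff.rfl
  -- The invariant `hs` says precisely that the tuple of values is guarded, so cutting the relation
  -- down to its guarded part changes nothing.
  | app X x =>
    refine ⟨fun h => ⟨h, ?_⟩, fun h => h.1⟩
    rw [freeVars, ← Set.range_comp] at hs
    exact hs
  | not _ ih => exact not_congr (ih hs)
  | and _ _ ihφ ihψ =>
    exact and_congr (ihφ (hs.mono (Set.image_mono Set.subset_union_left)))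
      (ihψ (hs.mono (Set.image_mono Set.subset_union_right)))
  | or _ _ ihφ ihψ =>
    exact or_congr (ihφ (hs.mono (Set.image_mono Set.subset_union_left)))
      (ihψ (hs.mono (Set.image_mono Set.subset_union_right)))
  | exs ys hα _ hsub ih =>
    rw [realize_exs, realize_exs]
    refine exists_congr fun s' => and_congr_right fun _ => ?_
    simp only [Realize]
    rw [hα.realize_iff (fun _ _ => True) (IsGuardedRel L) s' S (guardedPart L S)]
    exact and_congr_right fun h => ih ((hα.isGuardedSet h).mono (Set.image_mono hsub))
  | alls ys hα _ hsub ih =>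
    rw [realize_alls, realize_alls]
    refine forall_congr' fun s' => imp_congr_right fun _ => ?_
    simp only [Realize]
    rw [hα.realize_iff (fun _ _ => True) (IsGuardedRel L) s' S (guardedPart L S), ← imp_iff_not_or,
      ← imp_iff_not_or]
    exact imp_congr_right fun h => ih ((hα.isGuardedSet h).mono (Set.image_mono hsub))
  | exRel X _ ih =>
    constructor
    · rintro ⟨R, -, h⟩
      exact ⟨{t ∈ R | IsGuardedTuple L t}, fun t ht => ht.2,
        by rw [← guardedPart_update]; exact (ih hs).1 h⟩
    · rintro ⟨R, hR, h⟩
      refine ⟨R, trivial, (ih hs).2 ?_⟩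
      rwa [guardedPart_update, Set.sep_eq_self_iff_mem_true.2 hR]
  | allRel X _ ih =>
    constructor
    · intro h R hR
      have := (ih hs).1 (h R trivial)
      rwa [guardedPart_update, Set.sep_eq_self_iff_mem_true.2 hR] at this
    · intro h R _
      refine (ih hs).2 ?_
      rw [guardedPart_update]
      exact h _ fun t ht => ht.2

/-- A tuple of length one is guarded by an equality, so every unary relation is guarded. -/
theorem IsMonadic.realize_iff {φ : SOFormula L} (hφ : φ.IsMonadic) {s : ℕ → A}
    {S : ∀ X : RelVar, Set (Fin X.arity → A)} :
    φ.Realize (fun _ _ => True) s S ↔ φ.Realize (IsGuardedRel L) s S := by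
  have hunary : ∀ {k : ℕ} (_ : k = 1) (R : Set (Fin k → A)), IsGuardedRel L k R := by
    rintro k rfl R t -
    refine Or.inl ⟨t 0, ?_⟩
    rintro _ ⟨m, rfl⟩
    rw [Subsingleton.elim m 0]
    rfl
  induction φ generalizing s S with
  | eq x y => exact Iff.rfl
  | rel R x => exact Iff.rfl
  | app X x => exact Iff.rfl
  | not φ ih => exact not_congr (ih hφ)
  | and φ ψ ihφ ihψ => exact and_congr (ihφ hφ.1) (ihψ hφ.2)
  | or φ ψ ihφ ihψ => exact or_congr (ihφ hφ.1) (ihψ hφ.2)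
  | ex x φ ih => exact exists_congr fun a => ih hφ
  | all x φ ih => exact forall_congr' fun a => ih hφ
  | exRel X φ ih =>
    exact exists_congr fun R => and_congr (iff_of_true trivial (hunary hφ.1 R)) (ih hφ.2)
  | allRel X φ ih =>
    exact forall_congr' fun R => imp_congr (iff_of_true trivial (hunary hφ.1 R)) (ih hφ.2)

end SOFormula

/-! ### From definability to finite index, via canonical structures. -/

section Expressibility

variable {L : FirstOrder.Language.{u, v}}

theorem InGSO.inGuardedSemanticsSO {C : Set (FinStr L)} (h : InGSO C) :
    InGuardedSemanticsSO C := by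
  obtain ⟨Φ, hΦ, hg, rfl⟩ := h
  refine ⟨Φ, hΦ, Set.ext fun A => forall_congr' fun s => forall_congr' fun S => ?_⟩
  rw [hg.realize_iff (by rw [hΦ.1, Set.image_empty]; exact Or.inl ⟨s 0, Set.empty_subset _⟩)]
  exact hΦ.realize_iff _ _ _ _ _

theorem InMSO.inGuardedSemanticsSO {C : Set (FinStr L)} (h : InMSO C) :
    InGuardedSemanticsSO C := by
  obtain ⟨Φ, hΦ, hm, rfl⟩ := h
  exact ⟨Φ, hΦ, Set.ext fun A => forall_congr' fun s => forall_congr' fun S => hm.realize_iff⟩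

/-- All bound variables of the formula are smaller than `m`. -/
def BoundedBy {n : ℕ} (m : ℕ) (F : Finset (Fact L (Fin n ⊕ ℕ))) : Prop :=
  ∀ f ∈ F, ∃ u : Fin f.1.1 → Fin n ⊕ Fin m, Sum.map id Fin.val ∘ u = f.2

/-- The bound is a successor so that the canonical structure is non-empty even when `n = 0`. -/
theorem exists_boundedBy {n : ℕ} (F : Finset (Fact L (Fin n ⊕ ℕ))) : ∃ m, BoundedBy (m + 1) F := by
  classical
  obtain ⟨m, hm⟩ := exists_facts_lt (F.image (Fact.map (Sum.elim (fun _ => 0) id)))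
  refine ⟨m, fun f hf => ?_⟩
  have : ∀ i, ∃ x : Fin n ⊕ Fin (m + 1), Sum.map id Fin.val x = f.2 i := by
    intro i
    have := hm _ (Finset.mem_image_of_mem _ hf) i
    simp only [Fact.map, Function.comp_apply] at this
    rcases hfi : f.2 i with x | x
    · exact ⟨.inl x, rfl⟩
    · rw [hfi] at this
      exact ⟨.inr ⟨x, Nat.lt_succ_of_lt this⟩, rfl⟩
  choose u hu using this
  exact ⟨u, funext hu⟩

variable [L.IsRelational]

/-- The canonical structure of a primitive positive formula with `n` free variables and `m`
bound variables. -/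
def CanonicalStr {n : ℕ} (_ : Finset (Fact L (Fin n ⊕ ℕ))) (m : ℕ) : Type := Fin n ⊕ Fin m

instance {n m : ℕ} (F : Finset (Fact L (Fin n ⊕ ℕ))) : L.Structure (CanonicalStr F m) :=
  structureOfFacts {f | Fact.map (Sum.map id Fin.val) f ∈ F}

/-- The free amalgam over the free variables of the canonical structures of two primitive
positive formulas. -/
def CanonicalAmalgam {n : ℕ} (_ _ : Finset (Fact L (Fin n ⊕ ℕ))) (m m' : ℕ) : Type :=
  Fin n ⊕ (Fin m ⊕ Fin m')

section Canonical

variable {n m m' : ℕ} (F G : Finset (Fact L (Fin n ⊕ ℕ)))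

/-- The embedding of the left canonical structure into the amalgam. -/
def CanonicalAmalgam.inl : CanonicalStr F m → CanonicalAmalgam F G m m' := Sum.map id Sum.inl

/-- The embedding of the right canonical structure into the amalgam. -/
def CanonicalAmalgam.inr : CanonicalStr G m' → CanonicalAmalgam F G m m' := Sum.map id Sum.inr

instance : L.Structure (CanonicalAmalgam F G m m') where
  funMap f := isEmptyElim f
  RelMap R t := t ∈ (fun u => CanonicalAmalgam.inl F G ∘ u) '' {u | Structure.RelMap R u} ∪
    (fun u => CanonicalAmalgam.inr F G ∘ u) '' {u | Structure.RelMap R u}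

theorem CanonicalAmalgam.isFreeAmalgam :
    IsFreeAmalgam (L := L) (A := CanonicalStr F m) (B := CanonicalStr G m') (n := n)
      (Sum.inl : Fin n → Fin n ⊕ Fin m) (Sum.inl : Fin n → Fin n ⊕ Fin m')
      (CanonicalAmalgam.inl F G) (CanonicalAmalgam.inr F G (m := m)) where
  injective_left := Function.Injective.sumMap Function.injective_id Sum.inl_injective
  injective_right := Function.Injective.sumMap Function.injective_id Sum.inr_injective
  eq_iff := by
    rintro (x | x) (y | y)
    · constructor
      · intro h
        obtain rfl : x = y := Sum.inl_injective h
        exact ⟨x, rfl, rfl⟩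
      · rintro ⟨l, hl, hl'⟩
        obtain rfl : l = x := Sum.inl_injective hl
        obtain rfl : l = y := Sum.inl_injective hl'
        rfl
    · exact ⟨fun h => (Sum.inl_ne_inr h).elim, fun ⟨l, _, h⟩ => (Sum.inl_ne_inr h).elim⟩
    · exact ⟨fun h => (Sum.inr_ne_inl h).elim, fun ⟨l, h, _⟩ => (Sum.inl_ne_inr h).elim⟩
    · exact ⟨fun h => (Sum.inl_ne_inr (Sum.inr_injective h)).elim,
        fun ⟨l, h, _⟩ => (Sum.inl_ne_inr h).elim⟩
  cover := by
    rintro (x | x | x)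
    · exact Or.inl ⟨Sum.inl x, rfl⟩
    · exact Or.inl ⟨Sum.inr x, rfl⟩
    · exact Or.inr ⟨Sum.inr x, rfl⟩
  relMap_iff _ _ := Iff.rfl

/-- The amalgam is a pushout: a homomorphism from it is a pair of homomorphisms agreeing on the free
variables. -/
theorem jointlySat_iff {T : Type w} [L.Structure T] [Nonempty T] {F G : Finset (Fact L (Fin n ⊕ ℕ))}
    (hF : BoundedBy m F) (hG : BoundedBy m' G) :
    JointlySat T F G ↔ Nonempty (CanonicalAmalgam F G m m' →[L] T) := by
  constructor
  · rintro ⟨h, g, g', hF, hG⟩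
    refine ⟨⟨Sum.elim h (Sum.elim (g ∘ Fin.val) (g' ∘ Fin.val)), fun f => isEmptyElim f, ?_⟩⟩
    rintro k R _ (⟨u, hu, rfl⟩ | ⟨u, hu, rfl⟩)
    · have e : Sum.elim h (Sum.elim (g ∘ Fin.val) (g' ∘ Fin.val)) ∘
          CanonicalAmalgam.inl F G (m' := m') ∘ u =
          Sum.elim h g ∘ Sum.map id Fin.val ∘ u := by
        refine funext fun x => (?_ : ∀ z, Sum.elim _ _ (CanonicalAmalgam.inl F G z) =
          Sum.elim h g (Sum.map id Fin.val z)) (u x)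
        rintro (y | y) <;> rfl
      exact (congrArg (Structure.RelMap R) e).mpr (hF _ hu)
    · have e : Sum.elim h (Sum.elim (g ∘ Fin.val) (g' ∘ Fin.val)) ∘
          CanonicalAmalgam.inr F G (m := m) ∘ u =
          Sum.elim h g' ∘ Sum.map id Fin.val ∘ u := by
        refine funext fun x => (?_ : ∀ z, Sum.elim _ _ (CanonicalAmalgam.inr F G z) =
          Sum.elim h g' (Sum.map id Fin.val z)) (u x)
        rintro (y | y) <;> rfl
      exact (congrArg (Structure.RelMap R) e).mpr (hG _ hu)
  · rintro ⟨φ⟩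
    refine ⟨fun x => φ (Sum.inl x),
      fun x => if h : x < m then φ (Sum.inr (Sum.inl ⟨x, h⟩)) else Classical.arbitrary T,
      fun x => if h : x < m' then φ (Sum.inr (Sum.inr ⟨x, h⟩)) else Classical.arbitrary T,
      fun f hf => ?_, fun f hf => ?_⟩
    · obtain ⟨u, hu⟩ := hF f hf
      have hu' : Structure.RelMap (M := CanonicalStr F m) f.1.2 u := by
        change Fact.map _ (⟨f.1, u⟩ : Fact L (Fin n ⊕ Fin m)) ∈ F
        simp only [Fact.map, hu]
        exact hf
      have := φ.map_rel f.1.2 (CanonicalAmalgam.inl F G ∘ u) (Or.inl ⟨u, hu', rfl⟩)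
      convert this using 1
      rw [← hu]
      refine funext fun x => (?_ : ∀ z, Sum.elim _ _ (Sum.map id Fin.val z) =
        φ (CanonicalAmalgam.inl F G z)) (u x)
      rintro (y | y)
      · rfl
      · exact dif_pos y.2
    · obtain ⟨u, hu⟩ := hG f hf
      have hu' : Structure.RelMap (M := CanonicalStr G m') f.1.2 u := by
        change Fact.map _ (⟨f.1, u⟩ : Fact L (Fin n ⊕ Fin m')) ∈ G
        simp only [Fact.map, hu]
        exact hf
      have := φ.map_rel f.1.2 (CanonicalAmalgam.inr F G ∘ u) (Or.inr ⟨u, hu', rfl⟩)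
      convert this using 1
      rw [← hu]
      refine funext fun x => (?_ : ∀ z, Sum.elim _ _ (Sum.map id Fin.val z) =
        φ (CanonicalAmalgam.inr F G z)) (u x)
      rintro (y | y)
      · rfl
      · exact dif_pos y.2

end Canonical

theorem InGuardedSemanticsSO.finiteIndex {T : Type w} [L.Structure T] [Nonempty T]
    (h : InGuardedSemanticsSO (Csp L T)) : FiniteIndex L T := by
  intro n
  obtain ⟨Φ, hΦ, hC⟩ := h
  obtain ⟨τ, hτ, t, ht⟩ := composes n Φ
  choose m hm using fun F : Finset (Fact L (Fin n ⊕ ℕ)) => exists_boundedBy F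
  let conf : Finset (Fact L (Fin n ⊕ ℕ)) → Config L n := fun F =>
    { carrier := CanonicalStr F (m F + 1)
      label := Sum.inl
      -- All variables are valued on the right and all left relations are empty; the choice is
      -- harmless because `Φ` is a sentence.
      asg := fun _ => none
      rels := fun _ => ∅ }
  refine ⟨τ, hτ, fun F => t (conf F), fun F F' hFF' G hFG => ?_⟩
  have hmem : ∀ F, JointlySat T F G ↔ ∀ s S,
      Φ.Realize (A := CanonicalAmalgam F G (m F + 1) (m G + 1)) (IsGuardedRel L) s S := by
    intro F
    rw [jointlySat_iff (hm F) (hm G)]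
    have : Finite (CanonicalAmalgam F G (m F + 1) (m G + 1)) :=
      inferInstanceAs (Finite (Fin n ⊕ (Fin (m F + 1) ⊕ Fin (m G + 1))))
    have : Nonempty (CanonicalAmalgam F G (m F + 1) (m G + 1)) := ⟨Sum.inr (Sum.inl 0)⟩
    exact Set.ext_iff.1 hC ⟨CanonicalAmalgam F G (m F + 1) (m G + 1)⟩
  rw [hmem] at hFG ⊢
  have := ht (conf F) (conf F') hFF' (B := CanonicalStr G (m G + 1)) _ _ _ _ _
    (CanonicalAmalgam.isFreeAmalgam F G) (CanonicalAmalgam.isFreeAmalgam F' G)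
    (fun _ => Sum.inr 0) (fun _ => ∅) (hFG _ _)
  exact fun s S => (hΦ.realize_iff _ _ _ _ _).1 this

end Expressibility

end GSOCsp

theorem corollary4p2 (L : FirstOrder.Language.{u, v}) [L.IsRelational]
    [Finite (Σ n : ℕ, L.Relations n)] (T : Type w) [L.Structure T] [Nonempty T]
    (C : Set (GSOCsp.FinStr L)) (hC : C = GSOCsp.Csp L T)
    (hexpr : GSOCsp.InGSO C ∨ GSOCsp.InGuardedSemanticsSO C ∨ GSOCsp.InMSO C) :
    ∃ (B : Type) (_ : L.Structure B), Nonempty B ∧ Countable B ∧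
      GSOCsp.IsOmegaCategorical L B ∧ C = GSOCsp.Csp L B := by
  subst hC
  have hSO : GSOCsp.InGuardedSemanticsSO (GSOCsp.Csp L T) :=
    hexpr.elim (·.inGuardedSemanticsSO) (·.elim id (·.inGuardedSemanticsSO))
  obtain ⟨_, hT⟩ := GSOCsp.exists_isGeneric (L := L) T
  exact ⟨ℕ, inferInstance, inferInstance, inferInstance,
    (hT.finitelyManyTypes hSO.finiteIndex).isOmegaCategorical, hT.csp_eq⟩
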